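/- Let $\gamma>0$, $\beta_0\in\mathbb R^p$, and let $(X_i,Y_i)$, $i\ge 1$, be i.i.d. copies of $(X,Y)$ with values in $\mathbb R^p\times\{0,1\}$. Write $\pi(x;\beta)=\frac{e^{\beta^\top x}}{1+e^{\beta^\top x}}$, $\nu(x;\beta)=\pi(x;\beta)\{1-\pi(x;\beta)\}$, $f(y|x;\beta)=\pi(x;\beta)^y\{1-\pi(x;\beta)\}^{1-y}$, $\|f(\cdot|x;\beta)\|_{\gamma+1}=[\pi(x;\beta)^{\gamma+1}+\{1-\pi(x;\beta)\}^{\gamma+1}]^{1/(\gamma+1)}$, and $$w_\gamma(\beta;x,y)=\Big(\frac{\exp\{y(\gamma+1)\beta^\top x\}}{1+\exp\{(\gamma+1)\beta^\top x\}}\Big)^{\frac{\gamma}{\gamma+1}},\qquad \psi_\beta(x,y)=w_\gamma(\beta;x,y)\{y-\pi(x;(\gamma+1)\beta)\}\,x .$$ Assume that the logistic model holds, $P(Y=1|X)=\pi(X;\beta_0)$ a.s., and that the matrix $$H_\gamma=E\big[\|f(\cdot|X;\beta_0)\|_{\gamma+1}\,\nu(X;(\gamma+1)\beta_0)\,XX^\top\big]$$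 is invertible. Assume that the influence function $\mathsf{IF}_\beta(x,y)=H_\gamma^{-1}\psi_\beta(x,y)$ has a finite second moment at $\beta=\beta_0$, locally uniformly: for some $\delta>0$, $\sup_{\|\beta-\beta_0\|<\delta}\|\mathsf{IF}_{\beta}(X,Y)\|^2$ is bounded by an integrable random variable (this holds, for instance, if $E\|X\|^2<\infty$). Let $\widehat\beta_\gamma$ (based on $n$ observations) be the $\gamma$-logistic estimator, that is, a random vector that, with probability tending to one, is a maximizer over $\beta\in\mathbb R^p$ of $$\frac1n\sum_{i=1}^n\Big(\frac{f(Y_i|X_i;\beta)}{\|f(\cdot|X_i;\beta)\|_{\gamma+1}}\Big)^\gamma .$$ Then the matrices $H_\gamma$ and $U_\gamma=E[w_\gamma(\beta_0;X,Y)^2\{Y-\pi(X;(\gamma+1)\beta_0)\}^2XX^\top]$ are finite. The matrix $$\Delta_\gamma=\gamma\,E\Big[w_\gamma(\beta_0;X,Y)\big[\nu(X;(\gamma+1)\beta_0)-\{Y-\pi(X;(\gamma+1)\beta_0)\}^2\big]XX^\top\Big]$$ is well defined and equal to $0$, and $E[-\frac{\partial}{\partial\beta}\psi_\beta(X,Y)|_{\beta=\beta_0}]$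 is well defined and equal to $H_\gamma$. With probability tending to one, $\widehat\beta_\gamma$ solves the weighted estimating equation $S_\gamma(\beta)=\frac1n\sum_{i=1}^n\psi_\beta(X_i,Y_i)=0$. Finally, as $n\to\infty$, $$\sqrt n\,(\widehat\beta_\gamma-\beta_0)\ \xrightarrow{d}\ N\big(0,\;H_\gamma^{-1}U_\gamma H_\gamma^{-1}\big).$$ -/

import Mathlib

open MeasureTheory ProbabilityTheory Filter Topology
open scoped RealInnerProductSpace

noncomputable section

namespace GammaLogistic

/-- `ℝᵖ` with the Euclidean norm. -/
abbrev Vec (p : ℕ) := EuclideanSpace ℝ (Fin p)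

/-- The logistic success probability `π(x;β) = exp(βᵀx) / (1 + exp(βᵀx))`. -/
def prob {p : ℕ} (x β : Vec p) : ℝ :=
  Real.exp ⟪β, x⟫ / (1 + Real.exp ⟪β, x⟫)

/-- `ν(x;β) = π(x;β) {1 - π(x;β)}`. -/
def nu {p : ℕ} (x β : Vec p) : ℝ :=
  prob x β * (1 - prob x β)

/-- The conditional label probability `f(y|x;β) = π(x;β)^y {1 - π(x;β)}^(1-y)`, `y ∈ {0,1}`. -/
def pmf {p : ℕ} (y : ℝ) (x β : Vec p) : ℝ :=
  prob x β ^ y * (1 - prob x β) ^ (1 - y)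

/-- `‖f(·|x;β)‖_{γ+1} = [π(x;β)^(γ+1) + {1 - π(x;β)}^(γ+1)]^(1/(γ+1))`. -/
def pmfNorm {p : ℕ} (γ : ℝ) (x β : Vec p) : ℝ :=
  (prob x β ^ (γ + 1) + (1 - prob x β) ^ (γ + 1)) ^ (1 / (γ + 1))

/-- The weight
`w_γ(β; x, y) = (exp{y (γ+1) βᵀx} / (1 + exp{(γ+1) βᵀx}))^(γ/(γ+1))` of one observation. -/
def weight {p : ℕ} (γ : ℝ) (β x : Vec p) (y : ℝ) : ℝ :=
  (Real.exp (y * ((γ + 1) * ⟪β, x⟫)) / (1 + Real.exp ((γ + 1) * ⟪β, x⟫))) ^ (γ / (γ + 1))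

/-- The weighted score `w_γ(β; x, y) {y - π(x;(γ+1)β)} x` of one observation. -/
def score {p : ℕ} (γ : ℝ) (β x : Vec p) (y : ℝ) : Vec p :=
  (weight γ β x y * (y - prob x ((γ + 1) • β))) • x

/-- The empirical `γ`-divergence criterion `(1/n) ∑_{i<n} (f(yᵢ|xᵢ;β) / ‖f(·|xᵢ;β)‖_{γ+1})^γ`,
whose maximizer is the `γ`-logistic estimator. -/
def criterion {p : ℕ} (γ : ℝ) (n : ℕ) (x : ℕ → Vec p) (y : ℕ → ℝ) (β : Vec p) : ℝ :=
  (1 / (n : ℝ)) * ∑ i ∈ Finset.range n, (pmf (y i) (x i) β / pmfNorm γ (x i) β) ^ γ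

/-- The estimating function
`S_γ(β) = (1/n) ∑_{i<n} w_γ(β; xᵢ, yᵢ) {yᵢ - π(xᵢ;(γ+1)β)} xᵢ`. -/
def estFun {p : ℕ} (γ : ℝ) (n : ℕ) (x : ℕ → Vec p) (y : ℕ → ℝ) (β : Vec p) : Vec p :=
  (1 / (n : ℝ)) • ∑ i ∈ Finset.range n, score γ β (x i) (y i)

/-- The matrix `c x xᵀ`. -/
def outer {p : ℕ} (c : ℝ) (x : Vec p) : Matrix (Fin p) (Fin p) ℝ :=
  Matrix.of fun i j => c * (x i * x j)

/-- All entries of the random matrix `M` are integrable. -/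
def HasMean {Ω : Type*} [MeasurableSpace Ω] {p : ℕ} (μ : Measure Ω)
    (M : Ω → Matrix (Fin p) (Fin p) ℝ) : Prop :=
  ∀ i j, Integrable (fun ω => M ω i j) μ

/-- The entrywise expectation of the random matrix `M`. -/
def mean {Ω : Type*} [MeasurableSpace Ω] {p : ℕ} (μ : Measure Ω)
    (M : Ω → Matrix (Fin p) (Fin p) ℝ) : Matrix (Fin p) (Fin p) ℝ :=
  Matrix.of fun i j => ∫ ω, M ω i j ∂μ

/-- The integrand `‖f(·|x;β)‖_{γ+1} ν(x;(γ+1)β) x xᵀ` of `H_γ`. -/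
def hInt {p : ℕ} (γ : ℝ) (β x : Vec p) : Matrix (Fin p) (Fin p) ℝ :=
  outer (pmfNorm γ x β * nu x ((γ + 1) • β)) x

/-- The integrand `w_γ² {y - π(x;(γ+1)β)}² x xᵀ` of `U_γ`. -/
def uInt {p : ℕ} (γ : ℝ) (β x : Vec p) (y : ℝ) : Matrix (Fin p) (Fin p) ℝ :=
  outer (weight γ β x y ^ 2 * (y - prob x ((γ + 1) • β)) ^ 2) x

/-- The integrand `γ w_γ [ν(x;(γ+1)β) - {y - π(x;(γ+1)β)}²] x xᵀ` of `Δ_γ`. -/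
def deltaInt {p : ℕ} (γ : ℝ) (β x : Vec p) (y : ℝ) : Matrix (Fin p) (Fin p) ℝ :=
  outer (γ * (weight γ β x y *
    (nu x ((γ + 1) • β) - (y - prob x ((γ + 1) • β)) ^ 2))) x

/-- The negative Jacobian `-∂/∂β` of the weighted score of one observation. -/
def negJac {p : ℕ} (γ : ℝ) (β x : Vec p) (y : ℝ) : Matrix (Fin p) (Fin p) ℝ :=
  Matrix.of fun i j =>
    -(fderiv ℝ (fun b : Vec p => score γ b x y) β (EuclideanSpace.single j 1)) i

/-- `H_γ = E[‖f(·|X;β)‖_{γ+1} ν(X;(γ+1)β) X Xᵀ]`. -/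
def hMat {Ω : Type*} [MeasurableSpace Ω] {p : ℕ} (μ : Measure Ω) (γ : ℝ) (β : Vec p)
    (X : Ω → Vec p) : Matrix (Fin p) (Fin p) ℝ :=
  mean μ fun ω => hInt γ β (X ω)

/-- `U_γ = E[w_γ² {Y - π(X;(γ+1)β)}² X Xᵀ]`. -/
def uMat {Ω : Type*} [MeasurableSpace Ω] {p : ℕ} (μ : Measure Ω) (γ : ℝ) (β : Vec p)
    (X : Ω → Vec p) (Y : Ω → ℝ) : Matrix (Fin p) (Fin p) ℝ :=
  mean μ fun ω => uInt γ β (X ω) (Y ω)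

/-- `H⁻¹` applied to the weighted score at `β`; at the true parameter `β = β₀` and with
`H = H_γ` this is the influence function of the `γ`-logistic estimator at `(x, y)`. -/
def influence {p : ℕ} (γ : ℝ) (H : Matrix (Fin p) (Fin p) ℝ) (β x : Vec p) (y : ℝ) : Vec p :=
  Matrix.toEuclideanLin H⁻¹ (score γ β x y)

end GammaLogistic

end

/-!
Each label `y ∈ {0, 1}` is absorbed into the covariate: with `v = (2 y - 1) x`, the summand of the
criterion is `w ⟪β, v⟫` and the weighted score is `g ⟪β, v⟫ • v` for two functions `w`, `g` of the
margin with `w' = γ g` (`marginWeight`, `marginScore`). The estimator is thus an M-estimator with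
a bounded criterion and the estimating equation is its first-order condition.

*Moments.* No moment of `X` is assumed. By `exists_exp_neg_margin_mul_sq_le`, if the squared score
is dominated on a ball of parameters, then so is `exp (-γ |⟪β, v⟫|) ‖v‖²` on a smaller ball, and
this quantity dominates the derivative of the score and the integrands of all the matrices. The
identities for `Δ_γ` and for the expected Jacobian come from averaging over the label given `X`
(`integral_comp_signed`), where `π g(t) = (1 - π) g(-t)` makes the score unbiased.

*Consistency.* Given `X`, the expected criterion is a strictly concave function of
`π(X; (γ + 1) β) ∈ [0, 1]` whose only maximum is at `β₀` (`expected_weight_lt`), also when the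
values `0` and `1`, attained at infinity, are admitted. The parameter space is not compact, and
limits along `β → ∞` depend on the whole sequence of nested limiting directions. Every
ultrafilter of parameters nevertheless has a countably generated coarsening along which all the
functionals `⟪·, x⟫` converge in `[-∞, ∞]`
(`exists_isCountablyGenerated_ge_forall_inner_tendsto`). By dominated convergence this gives, for
each ultrafilter not converging to `β₀`, a member on which the supremum of the weight has
expectation below the maximal one. The strong law then makes the criterion on that member smaller
than at `β₀`; sets with this property form an ideal, so it contains the exterior of each ball
around `β₀` (`ae_eventually_forall_sum_lt`).

*Asymptotic normality.* The oscillation of the derivative of the score over small balls has small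
mean, so that a consistent root differs from its linear approximation by a negligible relative
error (`tendsto_measure_relative_error`). The linear approximation is the normalized sum of the
influence functions, to which the central limit theorem in `ℝᵖ` applies
(`tendstoInDistribution_inv_sqrt_smul_sum`), and the error is removed by Slutsky's theorem.
-/

noncomputable section

namespace GammaLogistic

/-! ### The criterion as a function of the margin -/

/-- The weight of an observation as a function of its margin `t = ⟪β, v⟫`, where `v = ± x`
according to the label. -/
def marginWeight (γ t : ℝ) : ℝ := Real.sigmoid ((γ + 1) * t) ^ (γ / (γ + 1))

/-- The scalar factor of the weighted score, as a function of the margin. -/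
def marginScore (γ t : ℝ) : ℝ := marginWeight γ t * (1 - Real.sigmoid ((γ + 1) * t))

/-- The negative derivative of `marginScore`. -/
def marginCurv (γ t : ℝ) : ℝ :=
  marginScore γ t * ((2 * γ + 1) * Real.sigmoid ((γ + 1) * t) - γ)

/-- The covariate with the sign of its label: `x` if `y = 1` and `-x` if `y = 0`. -/
def signed {p : ℕ} (x : Vec p) (y : ℝ) : Vec p := (2 * y - 1) • x

lemma sigmoid_eq_exp_mul (t : ℝ) : Real.sigmoid t = Real.exp t * (1 - Real.sigmoid t) := by
  rw [← Real.sigmoid_neg, ← Real.sigmoid_mul_rexp_neg, mul_left_comm, ← Real.exp_add]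
  simp

lemma one_sub_sigmoid_pos (t : ℝ) : 0 < 1 - Real.sigmoid t := by
  linarith [Real.sigmoid_lt_one t]

lemma exp_div_one_add_exp (t : ℝ) : Real.exp t / (1 + Real.exp t) = Real.sigmoid t := by
  have h := Real.exp_pos t
  rw [Real.sigmoid_def, Real.exp_neg]
  field_simp
  ring

lemma one_sub_sigmoid (t : ℝ) : 1 - Real.sigmoid t = (1 + Real.exp t)⁻¹ := by
  rw [← Real.sigmoid_neg, Real.sigmoid_def, neg_neg]

section

variable {γ : ℝ}

lemma marginWeight_pos (γ t : ℝ) : 0 < marginWeight γ t :=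
  Real.rpow_pos_of_pos (Real.sigmoid_pos _) _

lemma marginWeight_le_one (hγ : 0 < γ) (t : ℝ) : marginWeight γ t ≤ 1 :=
  Real.rpow_le_one (Real.sigmoid_nonneg _) (Real.sigmoid_le_one _) (by positivity)

lemma marginScore_pos (γ t : ℝ) : 0 < marginScore γ t :=
  mul_pos (marginWeight_pos γ t) (one_sub_sigmoid_pos _)

lemma marginWeight_neg (γ t : ℝ) :
    marginWeight γ (-t) = (1 - Real.sigmoid ((γ + 1) * t)) ^ (γ / (γ + 1)) := by
  rw [marginWeight, mul_neg, Real.sigmoid_neg]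

lemma marginScore_neg (γ t : ℝ) :
    marginScore γ (-t) = marginWeight γ (-t) * Real.sigmoid ((γ + 1) * t) := by
  rw [marginScore, mul_neg, Real.sigmoid_neg, sub_sub_cancel]

lemma marginWeight_eq_exp_mul (hγ : 0 < γ) (t : ℝ) :
    marginWeight γ t = Real.exp (γ * t) * marginWeight γ (-t) := by
  rw [marginWeight_neg, marginWeight]
  nth_rewrite 1 [sigmoid_eq_exp_mul]
  rw [Real.mul_rpow (Real.exp_nonneg _) (one_sub_sigmoid_pos _).le, ← Real.exp_mul]
  congr 2
  field_simp

lemma hasDerivAt_sigmoid_const_mul (c t : ℝ) :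
    HasDerivAt (fun t => Real.sigmoid (c * t))
      (Real.sigmoid (c * t) * (1 - Real.sigmoid (c * t)) * c) t :=
  ((Real.hasDerivAt_sigmoid (c * t)).comp t ((hasDerivAt_id t).const_mul c)).congr_deriv
    (by simp)

lemma hasDerivAt_marginWeight (hγ : 0 < γ) (t : ℝ) :
    HasDerivAt (marginWeight γ) (γ * marginScore γ t) t := by
  have h2 := (hasDerivAt_sigmoid_const_mul (γ + 1) t).rpow_const (p := γ / (γ + 1))
    (Or.inl (Real.sigmoid_pos _).ne')
  refine h2.congr_deriv ?_
  have h3 := Real.sigmoid_pos ((γ + 1) * t)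
  rw [Real.rpow_sub_one h3.ne', marginScore, marginWeight]
  field_simp

lemma hasDerivAt_marginScore (hγ : 0 < γ) (t : ℝ) :
    HasDerivAt (marginScore γ) (-marginCurv γ t) t := by
  have h1 := (hasDerivAt_sigmoid_const_mul (γ + 1) t).const_sub 1
  refine ((hasDerivAt_marginWeight hγ t).mul h1).congr_deriv ?_
  rw [marginCurv, marginScore]
  ring

lemma continuous_marginWeight (hγ : 0 < γ) : Continuous (marginWeight γ) :=
  continuous_iff_continuousAt.2 fun t => (hasDerivAt_marginWeight hγ t).continuousAt

lemma continuous_marginScore (hγ : 0 < γ) : Continuous (marginScore γ) :=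
  continuous_iff_continuousAt.2 fun t => (hasDerivAt_marginScore hγ t).continuousAt

lemma continuous_marginCurv (hγ : 0 < γ) : Continuous (marginCurv γ) := by
  unfold marginCurv
  exact (continuous_marginScore hγ).mul
    ((continuous_const.mul (continuous_sigmoid.comp (by fun_prop))).sub continuous_const)

lemma marginScore_le_exp (hγ : 0 < γ) (t : ℝ) :
    marginScore γ t ≤ Real.exp (-(γ * |t|)) := by
  rcases le_total 0 t with h | h
  · rw [abs_of_nonneg h]
    calc marginScore γ t ≤ 1 * (1 - Real.sigmoid ((γ + 1) * t)) := by
          exact mul_le_mul_of_nonneg_right (marginWeight_le_one hγ t) (one_sub_sigmoid_pos _).le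
      _ = Real.sigmoid ((γ + 1) * t) * Real.exp (-((γ + 1) * t)) := by
          rw [Real.sigmoid_mul_rexp_neg, Real.sigmoid_neg, one_mul]
      _ ≤ 1 * Real.exp (-((γ + 1) * t)) := by
          gcongr
          exact Real.sigmoid_le_one _
      _ ≤ Real.exp (-(γ * t)) := by
          rw [one_mul]
          gcongr
          linarith
  · rw [abs_of_nonpos h]
    calc marginScore γ t ≤ marginWeight γ t * 1 := by
          refine mul_le_mul_of_nonneg_left ?_ (marginWeight_pos γ t).le
          linarith [Real.sigmoid_nonneg ((γ + 1) * t)]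
      _ = Real.exp (γ * t) * marginWeight γ (-t) := by
          rw [mul_one, marginWeight_eq_exp_mul hγ]
      _ ≤ Real.exp (γ * t) * 1 := by
          gcongr
          exact marginWeight_le_one hγ _
      _ = Real.exp (-(γ * -t)) := by simp

lemma abs_marginCurv_le (hγ : 0 < γ) (t : ℝ) :
    |marginCurv γ t| ≤ (γ + 1) * Real.exp (-(γ * |t|)) := by
  rw [marginCurv, abs_mul, mul_comm]
  have h0 := Real.sigmoid_nonneg ((γ + 1) * t)
  have h1 := Real.sigmoid_le_one ((γ + 1) * t)
  gcongr
  · rw [abs_le]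
    constructor <;> nlinarith
  · rw [abs_of_pos (marginScore_pos γ t)]
    exact marginScore_le_exp hγ t

/-! ### Identities and the strict maximum under the logistic model -/

/-- Under the logistic model the two labels contribute opposite amounts to the conditional
expectation of the weighted score, which is why the estimating equation is unbiased. -/
lemma sigmoid_mul_marginScore (hγ : 0 < γ) (t : ℝ) :
    Real.sigmoid t * marginScore γ t = (1 - Real.sigmoid t) * marginScore γ (-t) := by
  rw [marginScore_neg, marginScore, marginWeight_eq_exp_mul hγ t]
  have h : Real.exp ((γ + 1) * t) = Real.exp (γ * t) * Real.exp t := by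
    rw [← Real.exp_add]; ring_nf
  have h1 := sigmoid_eq_exp_mul t
  have h2 := sigmoid_eq_exp_mul ((γ + 1) * t)
  rw [h] at h2
  set q := Real.sigmoid t
  set r := Real.sigmoid ((γ + 1) * t)
  linear_combination (Real.exp (γ * t) * marginWeight γ (-t) * (1 - r)) * h1
    - ((1 - q) * marginWeight γ (-t)) * h2

lemma label_norm_eq (hγ : 0 < γ) (t : ℝ) :
    (Real.sigmoid t ^ (γ + 1) + (1 - Real.sigmoid t) ^ (γ + 1)) ^ (1 / (γ + 1)) =
      (1 - Real.sigmoid t) * (1 + Real.exp ((γ + 1) * t)) ^ (1 / (γ + 1)) := by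
  have hp := one_sub_sigmoid_pos t
  have hr : Real.sigmoid t ^ (γ + 1) + (1 - Real.sigmoid t) ^ (γ + 1) =
      (1 - Real.sigmoid t) ^ (γ + 1) * (1 + Real.exp ((γ + 1) * t)) := by
    nth_rewrite 1 [sigmoid_eq_exp_mul t]
    rw [Real.mul_rpow (Real.exp_nonneg _) hp.le, ← Real.exp_mul, mul_comm t]
    ring
  rw [hr, Real.mul_rpow (by positivity) (by positivity), ← Real.rpow_mul hp.le,
    mul_one_div_cancel (by positivity), Real.rpow_one]

/-- The conditional expectation of the weight under the logistic model is the
`(γ + 1)`-norm of the label probabilities. -/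
lemma sigmoid_mul_marginWeight_add (hγ : 0 < γ) (t : ℝ) :
    Real.sigmoid t * marginWeight γ t + (1 - Real.sigmoid t) * marginWeight γ (-t) =
      (Real.sigmoid t ^ (γ + 1) + (1 - Real.sigmoid t) ^ (γ + 1)) ^ (1 / (γ + 1)) := by
  have h : Real.exp ((γ + 1) * t) = Real.exp (γ * t) * Real.exp t := by
    rw [← Real.exp_add]; ring_nf
  have hl : Real.sigmoid t * marginWeight γ t + (1 - Real.sigmoid t) * marginWeight γ (-t) =
      (1 - Real.sigmoid t) * ((1 + Real.exp ((γ + 1) * t)) * marginWeight γ (-t)) := by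
    rw [marginWeight_eq_exp_mul hγ t, h]
    nth_rewrite 1 [sigmoid_eq_exp_mul t]
    ring
  rw [hl, label_norm_eq hγ, marginWeight_neg, one_sub_sigmoid ((γ + 1) * t),
    Real.inv_rpow (by positivity), ← Real.rpow_neg (by positivity)]
  congr 1
  nth_rewrite 1 [← Real.rpow_one (1 + Real.exp ((γ + 1) * t))]
  rw [← Real.rpow_add (by positivity)]
  congr 1
  field_simp
  ring

/-- Tangent line bound for `r ↦ r ^ a` at `r₀ > 0`, strict off the point of contact. -/
lemma rpow_lt_tangent {a r r₀ : ℝ} (ha0 : 0 < a) (ha1 : a < 1) (hr : 0 ≤ r) (hr₀ : 0 < r₀)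
    (hne : r ≠ r₀) : r ^ a < r₀ ^ a + a * (r - r₀) * (r₀ ^ a / r₀) := by
  have h1 : r = r₀ * (1 + (r - r₀) / r₀) := by field_simp; ring
  have h2 : (1 + (r - r₀) / r₀) ^ a < 1 + a * ((r - r₀) / r₀) := by
    apply rpow_one_add_lt_one_add_mul_self _ _ ha0 ha1
    · rw [le_div_iff₀ hr₀]; linarith
    · exact div_ne_zero (sub_ne_zero.2 hne) hr₀.ne'
  have h3 : 0 ≤ 1 + (r - r₀) / r₀ := by
    have : 1 + (r - r₀) / r₀ = r / r₀ := by field_simp; ring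
    rw [this]; positivity
  calc r ^ a = r₀ ^ a * (1 + (r - r₀) / r₀) ^ a := by
        rw [← Real.mul_rpow hr₀.le h3, ← h1]
    _ < r₀ ^ a * (1 + a * ((r - r₀) / r₀)) := by gcongr
    _ = _ := by ring

/-- The conditional expected criterion, as a function of `r = π(x; (γ + 1) β)`, extends to
`r ∈ [0, 1]` and there has its only maximum at the true parameter. -/
lemma expected_weight_lt (hγ : 0 < γ) (t : ℝ) {r : ℝ} (h0 : 0 ≤ r) (h1 : r ≤ 1)
    (hne : r ≠ Real.sigmoid ((γ + 1) * t)) :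
    Real.sigmoid t * r ^ (γ / (γ + 1)) + (1 - Real.sigmoid t) * (1 - r) ^ (γ / (γ + 1)) <
      Real.sigmoid t * marginWeight γ t + (1 - Real.sigmoid t) * marginWeight γ (-t) := by
  set s := Real.sigmoid ((γ + 1) * t) with hs
  have hs0 : 0 < s := Real.sigmoid_pos _
  have hs1 : 0 < 1 - s := one_sub_sigmoid_pos _
  have ha0 : 0 < γ / (γ + 1) := by positivity
  have ha1 : γ / (γ + 1) < 1 := by rw [div_lt_one (by positivity)]; linarith
  have e1 := rpow_lt_tangent ha0 ha1 h0 hs0 hne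
  have e2 := rpow_lt_tangent ha0 ha1 (sub_nonneg.2 h1) hs1 (fun h => hne (by linarith))
  have hb := sigmoid_mul_marginScore hγ t
  rw [marginScore_neg, marginScore, marginWeight_neg, marginWeight, ← hs] at hb
  rw [marginWeight_neg, marginWeight, ← hs]
  set a := γ / (γ + 1)
  have hb' : Real.sigmoid t * (s ^ a / s) = (1 - Real.sigmoid t) * ((1 - s) ^ a / (1 - s)) := by
    field_simp
    linarith
  have e1' := mul_lt_mul_of_pos_left e1 (Real.sigmoid_pos t)
  have e2' := mul_lt_mul_of_pos_left e2 (one_sub_sigmoid_pos t)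
  -- the first-order terms cancel by the unbiasedness identity
  have hc : Real.sigmoid t * (a * (r - s) * (s ^ a / s)) +
      (1 - Real.sigmoid t) * (a * ((1 - r) - (1 - s)) * ((1 - s) ^ a / (1 - s))) = 0 := by
    linear_combination (a * (r - s)) * hb'
  linarith

end

/-! ### The quantities of the model as functions of the margin -/

variable {p : ℕ} {γ : ℝ}

lemma prob_eq_sigmoid (x β : Vec p) : prob x β = Real.sigmoid ⟪β, x⟫ :=
  exp_div_one_add_exp _

lemma prob_smul_eq_sigmoid (x β : Vec p) (c : ℝ) :
    prob x (c • β) = Real.sigmoid (c * ⟪β, x⟫) := by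
  rw [prob_eq_sigmoid, real_inner_smul_left]

@[simp] lemma signed_one (x : Vec p) : signed x 1 = x := by
  norm_num [signed]

@[simp] lemma signed_zero (x : Vec p) : signed x 0 = -x := by
  norm_num [signed]

lemma norm_signed {y : ℝ} (hy : y = 0 ∨ y = 1) (x : Vec p) : ‖signed x y‖ = ‖x‖ := by
  rcases hy with rfl | rfl <;> simp

lemma abs_inner_signed {y : ℝ} (hy : y = 0 ∨ y = 1) (β x : Vec p) :
    |⟪β, signed x y⟫| = |⟪β, x⟫| := by
  rcases hy with rfl | rfl <;> simp

lemma outer_signed {y : ℝ} (hy : y = 0 ∨ y = 1) (c : ℝ) (x : Vec p) :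
    outer c (signed x y) = outer c x := by
  rcases hy with rfl | rfl <;> ext <;> simp [outer]

lemma weight_eq {y : ℝ} (hy : y = 0 ∨ y = 1) (β x : Vec p) :
    weight γ β x y = marginWeight γ ⟪β, signed x y⟫ := by
  rcases hy with rfl | rfl
  · rw [signed_zero, inner_neg_right, marginWeight_neg, one_sub_sigmoid, weight]
    simp
  · rw [signed_one, weight, marginWeight, one_mul, exp_div_one_add_exp]

lemma score_eq {y : ℝ} (hy : y = 0 ∨ y = 1) (β x : Vec p) :
    score γ β x y = marginScore γ ⟪β, signed x y⟫ • signed x y := by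
  rw [score, weight_eq hy, prob_smul_eq_sigmoid]
  rcases hy with rfl | rfl
  · rw [signed_zero, inner_neg_right, marginScore_neg, smul_neg, ← neg_smul]
    congr 1
    ring
  · rw [signed_one, marginScore]

lemma score_coeff_sq {y : ℝ} (hy : y = 0 ∨ y = 1) (β x : Vec p) :
    weight γ β x y ^ 2 * (y - prob x ((γ + 1) • β)) ^ 2 = marginScore γ ⟪β, signed x y⟫ ^ 2 := by
  rw [weight_eq hy, prob_smul_eq_sigmoid]
  rcases hy with rfl | rfl
  · rw [signed_zero, inner_neg_right, marginScore_neg]; ring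
  · rw [signed_one, marginScore]; ring

/-- The criterion is the average weight: raising `f / ‖f‖_{γ+1}` to the power `γ` gives `w_γ`. -/
lemma criterion_summand_eq (hγ : 0 < γ) {y : ℝ} (hy : y = 0 ∨ y = 1) (β x : Vec p) :
    (pmf y x β / pmfNorm γ x β) ^ γ = marginWeight γ ⟪β, signed x y⟫ := by
  set t := ⟪β, x⟫ with ht
  have hq := Real.sigmoid_pos t
  have hp := one_sub_sigmoid_pos t
  have hN : pmfNorm γ x β =
      (1 - Real.sigmoid t) * (1 + Real.exp ((γ + 1) * t)) ^ (1 / (γ + 1)) := by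
    rw [pmfNorm, prob_eq_sigmoid, ← ht, label_norm_eq hγ]
  have h0 : ((1 - Real.sigmoid t) / pmfNorm γ x β) ^ γ = marginWeight γ (-t) := by
    rw [hN, marginWeight_neg, one_sub_sigmoid ((γ + 1) * t), Real.inv_rpow (by positivity),
      div_mul_cancel_left₀ hp.ne', Real.inv_rpow (by positivity), ← Real.rpow_mul (by positivity)]
    congr 2
    ring
  rcases hy with rfl | rfl
  · rw [signed_zero, inner_neg_right, ← h0, pmf, prob_eq_sigmoid]
    simp [ht]
  · rw [signed_one, marginWeight_eq_exp_mul hγ, ← ht, ← h0, pmf, prob_eq_sigmoid, ← ht]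
    simp only [Real.rpow_one, sub_self, Real.rpow_zero, mul_one]
    have hNp : 0 < pmfNorm γ x β := by rw [hN]; positivity
    nth_rewrite 1 [sigmoid_eq_exp_mul t]
    rw [mul_div_assoc, Real.mul_rpow (Real.exp_nonneg _) (by positivity), ← Real.exp_mul,
      mul_comm t]

lemma hasFDerivAt_inner_const (v β : Vec p) :
    HasFDerivAt (fun b : Vec p => ⟪b, v⟫) (innerSL ℝ v) β := by
  have h : (fun b : Vec p => ⟪b, v⟫) = innerSL ℝ v := by
    ext b
    simp [real_inner_comm]
  rw [h]
  exact (innerSL ℝ v).hasFDerivAt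

lemma hasFDerivAt_marginWeight_inner (hγ : 0 < γ) (v β : Vec p) :
    HasFDerivAt (fun b : Vec p => marginWeight γ ⟪b, v⟫)
      ((γ * marginScore γ ⟪β, v⟫) • innerSL ℝ v) β := by
  have h := hasFDerivAt_inner_const v β
  exact (hasDerivAt_marginWeight hγ ⟪β, v⟫).comp_hasFDerivAt β h

lemma negJac_eq (hγ : 0 < γ) {y : ℝ} (hy : y = 0 ∨ y = 1) (β x : Vec p) :
    negJac γ β x y = outer (marginCurv γ ⟪β, signed x y⟫) (signed x y) := by
  set v := signed x y
  have h1 := ((hasDerivAt_marginScore hγ ⟪β, v⟫).comp_hasFDerivAt β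
    (hasFDerivAt_inner_const v β)).smul_const v
  have h2 : (fun b : Vec p => score γ b x y) = fun b => marginScore γ ⟪b, v⟫ • v :=
    funext fun b => score_eq hy b x
  ext i j
  rw [negJac, h2]
  simp only [Matrix.of_apply]
  have h3 : fderiv ℝ (fun b : Vec p => marginScore γ ⟪b, v⟫ • v) β = _ := h1.fderiv
  rw [h3]
  simp [outer, EuclideanSpace.inner_single_right]
  ring

/-! ### Directions to infinity -/

/-- Every ultrafilter of parameters is finer than a countably generated filter along which each
linear functional has a limit in `[-∞, ∞]`. This is the compactification of the parameter space
by nested directions: along the filter, the parameter leaves to infinity in a leading direction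
`u`, and the functionals orthogonal to `u` are treated by induction on the dimension. -/
theorem exists_isCountablyGenerated_ge_forall_inner_tendsto {E : Type*} [NormedAddCommGroup E]
    [InnerProductSpace ℝ E] [FiniteDimensional ℝ E] (F : Ultrafilter E) (W : Submodule ℝ E) :
    ∃ G : Filter E, G.IsCountablyGenerated ∧ ↑F ≤ G ∧ ∀ x ∈ W,
      (∃ l : ℝ, Tendsto (fun β => ⟪β, x⟫) G (𝓝 l)) ∨
        Tendsto (fun β => ⟪β, x⟫) G atTop ∨ Tendsto (fun β => ⟪β, x⟫) G atBot := by
  induction hn : Module.finrank ℝ W using Nat.strong_induction_on generalizing W with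
  | _ n ih =>
  set P : E → E := fun β => W.starProjection β with hP
  have hPW : ∀ β, P β ∈ W := fun β => W.starProjection_apply_mem β
  have hin : ∀ β, ∀ x ∈ W, ⟪β, x⟫ = ⟪P β, x⟫ := fun β x hx => by
    rw [hP, W.inner_starProjection_left_eq_right, W.starProjection_eq_self_iff.2 hx]
  by_cases hb : ∃ R : ℝ, {β | ‖P β‖ ≤ R} ∈ F
  · obtain ⟨R, hR⟩ := hb
    obtain ⟨b, -, hb⟩ := (isCompact_closedBall (0 : E) R).ultrafilter_le_nhds (F.map P) (by
      rw [le_principal_iff]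
      change P ⁻¹' _ ∈ F
      filter_upwards [hR] with β hβ
      simpa using hβ)
    refine ⟨comap P (𝓝 b), inferInstance, map_le_iff_le_comap.1 hb, fun x hx => Or.inl ⟨⟪b, x⟫, ?_⟩⟩
    have h1 : Tendsto (fun β => ⟪P β, x⟫) (comap P (𝓝 b)) (𝓝 ⟪b, x⟫) :=
      (tendsto_comap.inner tendsto_const_nhds)
    exact h1.congr fun β => (hin β x hx).symm
  · push Not at hb
    have hlarge : Tendsto (fun β => ‖P β‖) F atTop := by
      refine tendsto_atTop.2 fun R => ?_
      have := Ultrafilter.compl_mem_iff_notMem.2 (hb R)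
      filter_upwards [this] with β hβ
      exact (not_le.1 (show ¬ ‖P β‖ ≤ R from hβ)).le
    set N : E → E := fun β => ‖P β‖⁻¹ • P β with hN
    have hN1 : ∀ β, ‖N β‖ ≤ 1 := fun β => by
      rw [hN, norm_smul, norm_inv, norm_norm]
      exact inv_mul_le_one
    obtain ⟨u, -, hu⟩ := (isCompact_closedBall (0 : E) 1).ultrafilter_le_nhds (F.map N) (by
      rw [le_principal_iff]
      change N ⁻¹' _ ∈ F
      exact Filter.univ_mem' fun β => by simpa using hN1 β)
    have hu' : Tendsto N F (𝓝 u) := hu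
    have hu1 : ‖u‖ = 1 := by
      refine tendsto_nhds_unique hu'.norm (tendsto_const_nhds.congr' ?_)
      filter_upwards [hlarge.eventually_gt_atTop 0] with β hβ
      rw [hN, norm_smul, norm_inv, norm_norm, inv_mul_cancel₀ hβ.ne']
    have huW : u ∈ W := by
      refine W.closed_of_finiteDimensional.mem_of_tendsto hu' (Eventually.of_forall fun β => ?_)
      exact W.smul_mem _ (hPW β)
    have hu0 : u ≠ 0 := by
      rintro rfl
      simp at hu1
    have hlt : Module.finrank ℝ ↥(W ⊓ (ℝ ∙ u)ᗮ) < n := by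
      rw [← hn]
      refine Submodule.finrank_lt_finrank_of_lt (lt_of_le_of_ne inf_le_left fun h => hu0 ?_)
      have h1 : u ∈ (ℝ ∙ u)ᗮ := (h.ge huW).2
      rw [Submodule.mem_orthogonal_singleton_iff_inner_left] at h1
      exact inner_self_eq_zero.1 h1
    obtain ⟨G, hG, hFG, hlim⟩ := ih _ hlt (W ⊓ (ℝ ∙ u)ᗮ) rfl
    refine ⟨G ⊓ (comap (fun β => ‖P β‖) atTop ⊓ comap N (𝓝 u)), inferInstance,
      le_inf hFG (le_inf (map_le_iff_le_comap.1 hlarge) (map_le_iff_le_comap.1 hu)),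
      fun x hx => ?_⟩
    have hG1 : Tendsto (fun β => ‖P β‖)
        (G ⊓ (comap (fun β => ‖P β‖) atTop ⊓ comap N (𝓝 u))) atTop :=
      tendsto_comap.mono_left (inf_le_right.trans inf_le_left)
    have hG2 : Tendsto (fun β => ⟪N β, x⟫)
        (G ⊓ (comap (fun β => ‖P β‖) atTop ⊓ comap N (𝓝 u))) (𝓝 ⟪u, x⟫) :=
      (tendsto_comap.mono_left (inf_le_right.trans inf_le_right)).inner tendsto_const_nhds
    have hfac : (fun β => ‖P β‖ * ⟪N β, x⟫)
        =ᶠ[G ⊓ (comap (fun β => ‖P β‖) atTop ⊓ comap N (𝓝 u))] fun β => ⟪β, x⟫ := by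
      filter_upwards [hG1.eventually_gt_atTop 0] with β hβ
      rw [hin β x hx, hN, real_inner_smul_left, mul_inv_cancel_left₀ hβ.ne']
    rcases lt_trichotomy ⟪u, x⟫ 0 with h | h | h
    · exact Or.inr (Or.inr ((hG1.atTop_mul_neg h hG2).congr' hfac))
    · have hx' : x ∈ W ⊓ (ℝ ∙ u)ᗮ :=
        ⟨hx, (Submodule.mem_orthogonal_singleton_iff_inner_right).2 h⟩
      rcases hlim x hx' with ⟨l, hl⟩ | hl | hl
      · exact Or.inl ⟨l, hl.mono_left inf_le_left⟩
      · exact Or.inr (Or.inl (hl.mono_left inf_le_left))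
      · exact Or.inr (Or.inr (hl.mono_left inf_le_left))
    · exact Or.inr (Or.inl ((hG1.atTop_mul_pos h hG2).congr' hfac))

/-- Along the filter of the previous theorem, the success probabilities converge at every
covariate. -/
theorem exists_isCountablyGenerated_ge_forall_sigmoid_tendsto {p : ℕ} (F : Ultrafilter (Vec p)) :
    ∃ G : Filter (Vec p), G.IsCountablyGenerated ∧ ↑F ≤ G ∧ ∀ c : ℝ, ∀ x : Vec p, ∃ l : ℝ,
      Tendsto (fun β => Real.sigmoid (c * ⟪β, x⟫)) G (𝓝 l) := by
  obtain ⟨G, hG, hFG, h⟩ := exists_isCountablyGenerated_ge_forall_inner_tendsto F ⊤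
  refine ⟨G, hG, hFG, fun c x => ?_⟩
  simp_rw [← real_inner_smul_right]
  rcases h (c • x) trivial with ⟨l, hl⟩ | hl | hl
  · exact ⟨_, (continuous_sigmoid.tendsto l).comp hl⟩
  · exact ⟨_, Real.tendsto_sigmoid_atTop.comp hl⟩
  · exact ⟨_, Real.tendsto_sigmoid_atBot.comp hl⟩

/-! ### Expectations under the logistic model -/

lemma measurable_signed {p : ℕ} : Measurable fun z : Vec p × ℝ => signed z.1 z.2 := by
  unfold signed
  fun_prop

/-- Under the logistic model, averaging over the label given the covariate. -/
theorem integral_comp_signed {Ω : Type*} [MeasurableSpace Ω] {μ : Measure Ω}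
    [IsProbabilityMeasure μ] {p : ℕ} {β₀ : Vec p} {X : Ω → Vec p} {Y : Ω → ℝ}
    (hX : Measurable X) (hY : Measurable Y) (hY01 : ∀ ω, Y ω = 0 ∨ Y ω = 1)
    (hmodel : μ⟦Y ⁻¹' {1} | MeasurableSpace.comap X inferInstance⟧
      =ᵐ[μ] fun ω => prob (X ω) β₀)
    {f : Vec p → ℝ} (hf : Measurable f) (h1 : Integrable (fun ω => f (X ω)) μ)
    (h0 : Integrable (fun ω => f (-X ω)) μ) :
    ∫ ω, f (signed (X ω) (Y ω)) ∂μ =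
      ∫ ω, (Real.sigmoid ⟪β₀, X ω⟫ * f (X ω) + (1 - Real.sigmoid ⟪β₀, X ω⟫) * f (-X ω)) ∂μ := by
  set A : Set Ω := Y ⁻¹' {1}
  have hA : MeasurableSet A := hY (measurableSet_singleton 1)
  set I : Ω → ℝ := A.indicator fun _ => (1 : ℝ) with hI
  have hIint : Integrable I μ := (integrable_const 1).indicator hA
  have hIb : ∀ ω, ‖I ω‖ ≤ 1 := fun ω => by
    by_cases h : ω ∈ A <;> simp [hI, h]
  have hm : MeasurableSpace.comap X inferInstance ≤ (inferInstance : MeasurableSpace Ω) :=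
    hX.comap_le
  have key : ∀ g : Vec p → ℝ, Measurable g → Integrable (fun ω => g (X ω)) μ →
      Integrable (fun ω => g (X ω) * I ω) μ ∧
      Integrable (fun ω => Real.sigmoid ⟪β₀, X ω⟫ * g (X ω)) μ ∧
      ∫ ω, g (X ω) * I ω ∂μ = ∫ ω, Real.sigmoid ⟪β₀, X ω⟫ * g (X ω) ∂μ := by
    intro g hg hgi
    have hgI : Integrable (fun ω => g (X ω) * I ω) μ :=
      hgi.mul_bdd hIint.aestronglyMeasurable (ae_of_all _ hIb)
    have hsI : Integrable (fun ω => Real.sigmoid ⟪β₀, X ω⟫ * g (X ω)) μ := by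
      refine hgi.bdd_mul (c := 1) ?_ (ae_of_all _ fun ω => ?_)
      · exact (continuous_sigmoid.measurable.comp (by fun_prop)).aestronglyMeasurable
      · rw [Real.norm_of_nonneg (Real.sigmoid_nonneg _)]
        exact Real.sigmoid_le_one _
    refine ⟨hgI, hsI, ?_⟩
    have hgm : StronglyMeasurable[MeasurableSpace.comap X inferInstance] fun ω => g (X ω) :=
      (hg.comp (comap_measurable X)).stronglyMeasurable
    have h := condExp_mul_of_stronglyMeasurable_left (μ := μ) hgm hgI hIint
    rw [← integral_condExp hm]
    refine integral_congr_ae ?_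
    filter_upwards [h, hmodel] with ω h hω
    have hω' : (μ[I | MeasurableSpace.comap X inferInstance]) ω = prob (X ω) β₀ := hω
    change (μ[(fun ω => g (X ω)) * I | MeasurableSpace.comap X inferInstance]) ω = _
    rw [h, Pi.mul_apply, hω', prob_eq_sigmoid, mul_comm]
  obtain ⟨a1, b1, c1⟩ := key f hf h1
  obtain ⟨a0, b0, c0⟩ := key (fun x => f (-x)) (by fun_prop) h0
  have d0 : Integrable (fun ω => f (-X ω) - f (-X ω) * I ω) μ := h0.sub a0
  have e0 : Integrable (fun ω => f (-X ω) - Real.sigmoid ⟪β₀, X ω⟫ * f (-X ω)) μ := h0.sub b0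
  calc ∫ ω, f (signed (X ω) (Y ω)) ∂μ
      = ∫ ω, (f (X ω) * I ω + (f (-X ω) - f (-X ω) * I ω)) ∂μ := by
        refine integral_congr_ae (ae_of_all _ fun ω => ?_)
        rcases hY01 ω with h | h
        · simp [h, hI, A]
        · simp [h, hI, A]
    _ = ∫ ω, Real.sigmoid ⟪β₀, X ω⟫ * f (X ω) ∂μ +
          (∫ ω, f (-X ω) ∂μ - ∫ ω, Real.sigmoid ⟪β₀, X ω⟫ * f (-X ω) ∂μ) := by
        rw [integral_add a1 d0, integral_sub h0 a0, c1, c0]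
    _ = _ := by
        rw [← integral_sub h0 b0, ← integral_add b1 e0]
        refine integral_congr_ae (ae_of_all _ fun ω => ?_)
        ring

/-! ### Consistency -/

/-- The upper envelope of the weight over a set of parameters. -/
def supWeight {p : ℕ} (γ : ℝ) (A : Set (Vec p)) (v : Vec p) : ℝ :=
  ⨆ β : A, marginWeight γ ⟪(β : Vec p), v⟫

section

variable {p : ℕ} {γ : ℝ}

lemma bddAbove_marginWeight (hγ : 0 < γ) (A : Set (Vec p)) (v : Vec p) :
    BddAbove (Set.range fun β : A => marginWeight γ ⟪(β : Vec p), v⟫) :=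
  ⟨1, by rintro _ ⟨β, rfl⟩; exact marginWeight_le_one hγ _⟩

lemma marginWeight_le_supWeight (hγ : 0 < γ) {A : Set (Vec p)} {β : Vec p} (hβ : β ∈ A)
    (v : Vec p) : marginWeight γ ⟪β, v⟫ ≤ supWeight γ A v :=
  le_ciSup (bddAbove_marginWeight hγ A v) ⟨β, hβ⟩

lemma measurable_supWeight (hγ : 0 < γ) (A : Set (Vec p)) : Measurable (supWeight γ A) := by
  refine (lowerSemicontinuous_ciSup (bddAbove_marginWeight hγ A) fun β => ?_).measurable
  exact ((continuous_marginWeight hγ).comp (by fun_prop)).lowerSemicontinuous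

lemma norm_supWeight_le (hγ : 0 < γ) {A : Set (Vec p)} (hA : A.Nonempty) (v : Vec p) :
    ‖supWeight γ A v‖ ≤ 1 := by
  obtain ⟨β, hβ⟩ := hA
  have : Nonempty A := ⟨⟨β, hβ⟩⟩
  rw [Real.norm_of_nonneg ((marginWeight_pos γ _).le.trans (marginWeight_le_supWeight hγ hβ v))]
  exact ciSup_le fun _ => marginWeight_le_one hγ _

lemma measurable_marginWeight_inner (hγ : 0 < γ) (β : Vec p) :
    Measurable fun v : Vec p => marginWeight γ ⟪β, v⟫ :=
  ((continuous_marginWeight hγ).comp (by fun_prop)).measurable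

end

/-- A filter of parameters along which all linear functionals converge to those of `β₀`
converges to `β₀`. -/
lemma le_nhds_of_forall_inner_tendsto {p : ℕ} {G : Filter (Vec p)} {β₀ : Vec p}
    (h : ∀ x : Vec p, Tendsto (fun β => ⟪β, x⟫) G (𝓝 ⟪β₀, x⟫)) : G ≤ 𝓝 β₀ := by
  have h1 : Tendsto (fun β : Vec p => WithLp.ofLp β) G (𝓝 (WithLp.ofLp β₀)) := by
    refine tendsto_pi_nhds.2 fun i => ?_
    simpa [EuclideanSpace.inner_single_right] using h (EuclideanSpace.single i 1)
  exact ((PiLp.continuous_toLp 2 (fun _ : Fin p => ℝ)).tendsto _).comp h1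

section

variable {Ω : Type*} [MeasurableSpace Ω] {μ : Measure Ω} {p : ℕ}
  {γ : ℝ} {β₀ : Vec p}

/-- The strong law of large numbers for a function of an i.i.d. sequence. -/
lemma ae_tendsto_sum_comp_div {V : ℕ → Ω → Vec p} (hindep : iIndepFun V μ)
    (hident : ∀ i, IdentDistrib (V i) (V 0) μ μ) {f : Vec p → ℝ} (hf : Measurable f)
    (hi : Integrable (fun ω => f (V 0 ω)) μ) :
    ∀ᵐ ω ∂μ, Tendsto (fun n : ℕ => (∑ i ∈ Finset.range n, f (V i ω)) / n) atTop
      (𝓝 (∫ ω, f (V 0 ω) ∂μ)) :=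
  strong_law_ae_real (fun i ω => f (V i ω)) hi
    (fun _ _ hij => (hindep.indepFun hij).comp hf hf) (fun i => (hident i).comp hf)

/-- The local step of the consistency proof: an ultrafilter of parameters staying away from `β₀`
contains a set over which even the expected upper envelope of the weight is less than the
expected weight at `β₀`. -/
theorem exists_mem_integral_supWeight_lt [IsProbabilityMeasure μ] (hγ : 0 < γ)
    {X : Ω → Vec p} {Y : Ω → ℝ}
    (hX : Measurable X) (hY : Measurable Y) (hY01 : ∀ ω, Y ω = 0 ∨ Y ω = 1)
    (hmodel : μ⟦Y ⁻¹' {1} | MeasurableSpace.comap X inferInstance⟧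
      =ᵐ[μ] fun ω => prob (X ω) β₀)
    (hnd : ∀ W : Submodule ℝ (Vec p), (∀ᵐ ω ∂μ, X ω ∈ W) → W = ⊤)
    {F : Ultrafilter (Vec p)} (hF : ¬ (F : Filter (Vec p)) ≤ 𝓝 β₀) :
    ∃ A ∈ F, A.Nonempty ∧ ∫ ω, supWeight γ A (signed (X ω) (Y ω)) ∂μ <
      ∫ ω, marginWeight γ ⟪β₀, signed (X ω) (Y ω)⟫ ∂μ := by
  obtain ⟨G, hG, hFG, hlim⟩ := exists_isCountablyGenerated_ge_forall_sigmoid_tendsto F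
  have hGne : G.NeBot := F.neBot.mono hFG
  choose q hq using hlim (γ + 1)
  have hq0 : ∀ v, 0 ≤ q v := fun v =>
    ge_of_tendsto (hq v) (Eventually.of_forall fun _ => Real.sigmoid_nonneg _)
  have hq1 : ∀ v, q v ≤ 1 := fun v =>
    le_of_tendsto (hq v) (Eventually.of_forall fun _ => Real.sigmoid_le_one _)
  have hqneg : ∀ v, q (-v) = 1 - q v := fun v => by
    refine tendsto_nhds_unique (hq (-v)) (((hq v).const_sub 1).congr fun β => ?_)
    rw [inner_neg_right, mul_neg, Real.sigmoid_neg]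
  have hqm : Measurable q := by
    refine measurable_of_tendsto_metrizable' G
      (f := fun (β : Vec p) v => Real.sigmoid ((γ + 1) * ⟪β, v⟫)) (fun β => ?_)
      (tendsto_pi_nhds.2 hq)
    exact (continuous_sigmoid.comp (by fun_prop)).measurable
  have ha : 0 < γ / (γ + 1) := by positivity
  set ℓ : Vec p → ℝ := fun v => q v ^ (γ / (γ + 1)) with hℓ
  have hℓm : Measurable ℓ := hqm.pow_const _
  have hℓ0 : ∀ v, 0 ≤ ℓ v := fun v => Real.rpow_nonneg (hq0 v) _
  have hℓ1 : ∀ v, ℓ v ≤ 1 := fun v => Real.rpow_le_one (hq0 v) (hq1 v) ha.le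
  have hwlim : ∀ v, Tendsto (fun β => marginWeight γ ⟪β, v⟫) G (𝓝 (ℓ v)) := fun v =>
    (hq v).rpow_const (Or.inr ha.le)
  have hV : Measurable fun ω => signed (X ω) (Y ω) := measurable_signed.comp (hX.prodMk hY)
  obtain ⟨A, hA⟩ := G.exists_antitone_basis
  have hAne : ∀ k, (A k).Nonempty := fun k => hGne.nonempty_of_mem (hA.mem k)
  -- the envelopes over the basis sets decrease to the limit of the weights
  have hsup : ∀ v, Tendsto (fun k => supWeight γ (A k) v) atTop (𝓝 (ℓ v)) := by
    intro v
    rw [Metric.tendsto_atTop]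
    intro ε hε
    have h1 := (Metric.tendsto_nhds.1 (hwlim v)) (ε / 2) (by positivity)
    obtain ⟨K, -, hK⟩ := hA.toHasBasis.mem_iff.1 h1
    refine ⟨K, fun k hk => ?_⟩
    have h2 : ∀ β ∈ A k, |marginWeight γ ⟪β, v⟫ - ℓ v| < ε / 2 := fun β hβ =>
      hK (hA.antitone hk hβ)
    obtain ⟨β, hβ⟩ := hAne k
    have : Nonempty (A k) := ⟨⟨β, hβ⟩⟩
    have h3 : supWeight γ (A k) v ≤ ℓ v + ε / 2 :=
      ciSup_le fun b => by linarith [(abs_lt.1 (h2 b b.2)).2]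
    have h4 := marginWeight_le_supWeight hγ hβ v
    rw [Real.dist_eq, abs_lt]
    constructor <;> linarith [(abs_lt.1 (h2 β hβ)).1]
  have hconv : Tendsto (fun k => ∫ ω, supWeight γ (A k) (signed (X ω) (Y ω)) ∂μ) atTop
      (𝓝 (∫ ω, ℓ (signed (X ω) (Y ω)) ∂μ)) := by
    refine tendsto_integral_of_dominated_convergence (fun _ => 1) (fun k => ?_)
      (integrable_const 1) (fun k => ae_of_all _ fun ω => norm_supWeight_le hγ (hAne k) _)
      (ae_of_all _ fun ω => hsup _)
    exact ((measurable_supWeight hγ _).comp hV).aestronglyMeasurable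
  suffices hlt : ∫ ω, ℓ (signed (X ω) (Y ω)) ∂μ <
      ∫ ω, marginWeight γ ⟪β₀, signed (X ω) (Y ω)⟫ ∂μ by
    obtain ⟨k, hk⟩ := (hconv.eventually_lt_const hlt).exists
    exact ⟨A k, hFG (hA.mem k), hAne k, hk⟩
  have hbdd : ∀ {g : Vec p → ℝ} {Z : Ω → Vec p}, Measurable g → Measurable Z →
      (∀ v, 0 ≤ g v) → (∀ v, g v ≤ 1) → Integrable (fun ω => g (Z ω)) μ := by
    intro g Z hg hZ h0 h1
    refine Integrable.of_bound (hg.comp hZ).aestronglyMeasurable 1 (ae_of_all _ fun ω => ?_)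
    change ‖g (Z ω)‖ ≤ 1
    rw [Real.norm_of_nonneg (h0 _)]
    exact h1 _
  have hw := measurable_marginWeight_inner hγ β₀
  have hw0 : ∀ v : Vec p, 0 ≤ marginWeight γ ⟪β₀, v⟫ := fun v => (marginWeight_pos γ _).le
  have hw1 : ∀ v : Vec p, marginWeight γ ⟪β₀, v⟫ ≤ 1 := fun v => marginWeight_le_one hγ _
  rw [integral_comp_signed hX hY hY01 hmodel hℓm (hbdd hℓm hX hℓ0 hℓ1)
      (hbdd hℓm hX.neg hℓ0 hℓ1),
    integral_comp_signed hX hY hY01 hmodel hw (hbdd hw hX hw0 hw1) (hbdd hw hX.neg hw0 hw1)]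
  have hσ : Measurable fun x : Vec p => Real.sigmoid ⟪β₀, x⟫ :=
    (continuous_sigmoid.comp (by fun_prop)).measurable
  have hmix : ∀ {g : Vec p → ℝ}, Measurable g → (∀ v, 0 ≤ g v) → (∀ v, g v ≤ 1) →
      Integrable (fun ω => Real.sigmoid ⟪β₀, X ω⟫ * g (X ω) +
        (1 - Real.sigmoid ⟪β₀, X ω⟫) * g (-X ω)) μ := by
    intro g hg h0 h1
    refine hbdd (g := fun x => Real.sigmoid ⟪β₀, x⟫ * g x + (1 - Real.sigmoid ⟪β₀, x⟫) * g (-x))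
      ?_ hX (fun x => ?_) (fun x => ?_)
    · exact (hσ.mul hg).add ((measurable_const.sub hσ).mul (hg.comp measurable_neg))
    · have := one_sub_sigmoid_pos ⟪β₀, x⟫
      have := Real.sigmoid_pos ⟪β₀, x⟫
      have := h0 x
      have := h0 (-x)
      positivity
    · nlinarith [one_sub_sigmoid_pos ⟪β₀, x⟫, Real.sigmoid_pos ⟪β₀, x⟫, h1 x, h1 (-x)]
  have hiℓ := hmix hℓm hℓ0 hℓ1
  have hiw := hmix hw hw0 hw1
  have hstrict : ∀ x, q x ≠ Real.sigmoid ((γ + 1) * ⟪β₀, x⟫) →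
      Real.sigmoid ⟪β₀, x⟫ * ℓ x + (1 - Real.sigmoid ⟪β₀, x⟫) * ℓ (-x) <
        Real.sigmoid ⟪β₀, x⟫ * marginWeight γ ⟪β₀, x⟫ +
          (1 - Real.sigmoid ⟪β₀, x⟫) * marginWeight γ ⟪β₀, -x⟫ := by
    intro x hx
    rw [inner_neg_right]
    simp only [hℓ, hqneg]
    exact expected_weight_lt hγ _ (hq0 x) (hq1 x) hx
  have hle : ∀ x, Real.sigmoid ⟪β₀, x⟫ * ℓ x + (1 - Real.sigmoid ⟪β₀, x⟫) * ℓ (-x) ≤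
        Real.sigmoid ⟪β₀, x⟫ * marginWeight γ ⟪β₀, x⟫ +
          (1 - Real.sigmoid ⟪β₀, x⟫) * marginWeight γ ⟪β₀, -x⟫ := by
    intro x
    by_cases hx : q x = Real.sigmoid ((γ + 1) * ⟪β₀, x⟫)
    · rw [inner_neg_right, marginWeight_neg]
      simp only [hℓ, hqneg, hx, marginWeight]
      exact le_rfl
    · exact (hstrict x hx).le
  refine (integral_mono hiℓ hiw fun ω => hle (X ω)).lt_of_ne fun heq => hF ?_
  -- in the case of equality the limits agree with those at `β₀`, so the filter converges to `β₀`
  have hae := (integral_eq_iff_of_ae_le hiℓ hiw (ae_of_all _ fun ω => hle (X ω))).1 heq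
  let W : Submodule ℝ (Vec p) :=
    { carrier := {x | Tendsto (fun β => ⟪β, x⟫) G (𝓝 ⟪β₀, x⟫)}
      add_mem' := fun {x y} hx hy => by
        simp only [Set.mem_ofPred_eq, inner_add_right] at hx hy ⊢
        exact hx.add hy
      zero_mem' := by simp
      smul_mem' := fun c x hx => by
        simp only [Set.mem_ofPred_eq, real_inner_smul_right] at hx ⊢
        exact hx.const_mul c }
  have hW : W = ⊤ := by
    refine hnd W ?_
    filter_upwards [hae] with ω hω
    have hqx : q (X ω) = Real.sigmoid ((γ + 1) * ⟪β₀, X ω⟫) := by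
      by_contra hne
      exact (hstrict _ hne).ne hω
    have ht := hq (X ω)
    rw [hqx] at ht
    change Tendsto (fun β => ⟪β, X ω⟫) G (𝓝 ⟪β₀, X ω⟫)
    have hγ1 : 0 < γ + 1 := by positivity
    refine tendsto_order.2 ⟨fun b hb => ?_, fun b hb => ?_⟩
    · have h1 : Real.sigmoid ((γ + 1) * b) < Real.sigmoid ((γ + 1) * ⟪β₀, X ω⟫) :=
        Real.sigmoid_lt (mul_lt_mul_of_pos_left hb hγ1)
      filter_upwards [ht.eventually_const_lt h1] with β hβ
      exact lt_of_mul_lt_mul_left (Real.sigmoid_lt_iff.1 hβ) hγ1.le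
    · have h1 : Real.sigmoid ((γ + 1) * ⟪β₀, X ω⟫) < Real.sigmoid ((γ + 1) * b) :=
        Real.sigmoid_lt (mul_lt_mul_of_pos_left hb hγ1)
      filter_upwards [ht.eventually_lt_const h1] with β hβ
      exact lt_of_mul_lt_mul_left (Real.sigmoid_lt_iff.1 hβ) hγ1.le
  exact hFG.trans (le_nhds_of_forall_inner_tendsto fun x => (hW ▸ trivial : x ∈ W))

/-- Almost surely, for all large samples, the criterion is smaller at every parameter at distance
at least `ε` from `β₀` than at `β₀`. -/
theorem ae_eventually_forall_sum_lt [IsProbabilityMeasure μ] (hγ : 0 < γ)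
    {X : ℕ → Ω → Vec p} {Y : ℕ → Ω → ℝ}
    (hX : ∀ i, Measurable (X i)) (hY : ∀ i, Measurable (Y i))
    (hY01 : ∀ i ω, Y i ω = 0 ∨ Y i ω = 1)
    (hindep : iIndepFun (fun i ω => (X i ω, Y i ω)) μ)
    (hident : ∀ i, IdentDistrib (fun ω => (X i ω, Y i ω)) (fun ω => (X 0 ω, Y 0 ω)) μ μ)
    (hmodel : μ⟦Y 0 ⁻¹' {1} | MeasurableSpace.comap (X 0) inferInstance⟧
      =ᵐ[μ] fun ω => prob (X 0 ω) β₀)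
    (hnd : ∀ W : Submodule ℝ (Vec p), (∀ᵐ ω ∂μ, X 0 ω ∈ W) → W = ⊤)
    {ε : ℝ} (hε : 0 < ε) :
    ∀ᵐ ω ∂μ, ∀ᶠ n in atTop, ∀ β : Vec p, ε ≤ ‖β - β₀‖ →
      ∑ i ∈ Finset.range n, marginWeight γ ⟪β, signed (X i ω) (Y i ω)⟫ <
        ∑ i ∈ Finset.range n, marginWeight γ ⟪β₀, signed (X i ω) (Y i ω)⟫ := by
  have hVi : iIndepFun (fun i ω => signed (X i ω) (Y i ω)) μ :=
    hindep.comp (fun _ z => signed z.1 z.2) fun _ => measurable_signed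
  have hVd : ∀ i, IdentDistrib (fun ω => signed (X i ω) (Y i ω))
      (fun ω => signed (X 0 ω) (Y 0 ω)) μ μ := fun i => (hident i).comp measurable_signed
  have hV : Measurable fun ω => signed (X 0 ω) (Y 0 ω) :=
    measurable_signed.comp ((hX 0).prodMk (hY 0))
  set Good : Set (Vec p) → Prop := fun A => ∀ᵐ ω ∂μ, ∀ᶠ n in atTop, ∀ β ∈ A,
      ∑ i ∈ Finset.range n, marginWeight γ ⟪β, signed (X i ω) (Y i ω)⟫ <
        ∑ i ∈ Finset.range n, marginWeight γ ⟪β₀, signed (X i ω) (Y i ω)⟫ with hGood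
  have hlocal : ∀ F : Ultrafilter (Vec p), ¬ (F : Filter (Vec p)) ≤ 𝓝 β₀ → ∃ A ∈ F, Good A := by
    intro F hF
    obtain ⟨A, hAF, hAne, hlt⟩ := exists_mem_integral_supWeight_lt (μ := μ) hγ (hX 0) (hY 0)
      (hY01 0) hmodel hnd hF
    refine ⟨A, hAF, ?_⟩
    have hw := measurable_marginWeight_inner hγ β₀
    have h1 := ae_tendsto_sum_comp_div hVi hVd (measurable_supWeight hγ A)
      (Integrable.of_bound ((measurable_supWeight hγ A).comp hV).aestronglyMeasurable 1
        (ae_of_all _ fun ω => norm_supWeight_le hγ hAne _))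
    have h2 := ae_tendsto_sum_comp_div hVi hVd hw
      (Integrable.of_bound (hw.comp hV).aestronglyMeasurable 1 (ae_of_all _ fun ω => by
        rw [Real.norm_of_nonneg (marginWeight_pos _ _).le]
        exact marginWeight_le_one hγ _))
    filter_upwards [h1, h2] with ω h1 h2
    filter_upwards [h1.eventually_lt h2 hlt, eventually_gt_atTop 0] with n hn hn0 β hβ
    have hn0' : (0 : ℝ) < n := by exact_mod_cast hn0
    exact (Finset.sum_le_sum fun i _ => marginWeight_le_supWeight hγ hβ _).trans_lt
      ((div_lt_div_iff_of_pos_right hn0').1 hn)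
  -- good sets form an ideal; its complement filter cannot meet the exterior of the ball
  have hmono : ∀ t, Good t → ∀ s ⊆ t, Good s := fun t ht s hs => by
    filter_upwards [ht] with ω hω
    filter_upwards [hω] with n hn β hβ using hn β (hs hβ)
  have hunion : ∀ s, Good s → ∀ t, Good t → Good (s ∪ t) := fun s hs t ht => by
    filter_upwards [hs, ht] with ω h1 h2
    filter_upwards [h1, h2] with n h1 h2 β hβ
    exact hβ.elim (h1 β) (h2 β)
  have hempty : Good ∅ := ae_of_all _ fun ω => Eventually.of_forall fun n β hβ => hβ.elim
  let L : Filter (Vec p) := Filter.comk Good hempty hmono hunion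
  by_cases hbot : (L ⊓ 𝓟 {β | ε ≤ ‖β - β₀‖}).NeBot
  · exfalso
    set F := Ultrafilter.of (L ⊓ 𝓟 {β | ε ≤ ‖β - β₀‖})
    have hFle : (F : Filter (Vec p)) ≤ L ⊓ 𝓟 {β | ε ≤ ‖β - β₀‖} := Ultrafilter.of_le _
    have hF : ¬ (F : Filter (Vec p)) ≤ 𝓝 β₀ := fun h => by
      have h1 : Metric.ball β₀ ε ∈ F := h (Metric.ball_mem_nhds _ hε)
      have h2 : {β | ε ≤ ‖β - β₀‖} ∈ F := hFle (mem_inf_of_right (mem_principal_self _))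
      obtain ⟨β, hb1, hb2⟩ := F.neBot.nonempty_of_mem (inter_mem h1 h2)
      rw [Metric.mem_ball, dist_eq_norm] at hb1
      exact absurd hb1 (not_lt.2 hb2)
    obtain ⟨A, hAF, hA⟩ := hlocal F hF
    have hAc : Aᶜ ∈ L := by
      rw [Filter.mem_comk, compl_compl]
      exact hA
    exact Ultrafilter.compl_notMem_iff.2 hAF (hFle (mem_inf_of_left hAc))
  · rw [not_neBot, ← compl_compl {β : Vec p | ε ≤ ‖β - β₀‖}, ← mem_iff_inf_principal_compl,
      Filter.mem_comk, compl_compl] at hbot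
    exact hbot

end

/-! ### The multivariate central limit theorem -/

section

variable {Ω : Type*} [MeasurableSpace Ω] {μ : Measure Ω} [IsProbabilityMeasure μ] {p : ℕ}

/-- The central limit theorem in `ℝᵖ`, deduced from the real one by Lévy's theorem
(the Cramér–Wold device). -/
theorem tendstoInDistribution_inv_sqrt_smul_sum {Z : ℕ → Ω → Vec p} (hindep : iIndepFun Z μ)
    (hident : ∀ i, IdentDistrib (Z i) (Z 0) μ μ)
    (hL2 : ∀ u, MemLp (fun ω => ⟪u, Z 0 ω⟫) 2 μ) (hmean : ∀ u, ∫ ω, ⟪u, Z 0 ω⟫ ∂μ = 0)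
    {S : Matrix (Fin p) (Fin p) ℝ} (hS : S.PosSemidef)
    (hcov : ∀ u : Vec p, ∫ ω, ⟪u, Z 0 ω⟫ ^ 2 ∂μ = u.ofLp ⬝ᵥ S.mulVec u.ofLp) :
    TendstoInDistribution (fun (n : ℕ) ω => (√(n : ℝ))⁻¹ • ∑ i ∈ Finset.range n, Z i ω) atTop
      (id : Vec p → Vec p) (fun _ => μ) (multivariateGaussian 0 S) where
  forall_aemeasurable n :=
    (Finset.aemeasurable_fun_sum _ fun i _ => (hident i).aemeasurable_fst).fun_const_smul _
  tendsto := by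
    refine ProbabilityMeasure.tendsto_iff_tendsto_charFun.2 fun u => ?_
    have hm : Measurable fun z : Vec p => ⟪u, z⟫ := by fun_prop
    have hvar : Var[fun ω => ⟪u, Z 0 ω⟫; μ] = u.ofLp ⬝ᵥ S.mulVec u.ofLp := by
      rw [variance_eq_sub (hL2 u), hmean u, ← hcov u]
      simp
    have hclt := tendstoInDistribution_inv_sqrt_mul_sum_sub (P := μ)
      (X := fun i ω => ⟪u, Z i ω⟫)
      (HasLaw.id (μ := gaussianReal 0 Var[fun ω => ⟪u, Z 0 ω⟫; μ].toNNReal)) (hL2 u)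
      (hindep.comp (fun _ z => ⟪u, z⟫) fun _ => hm) (fun i => (hident i).comp hm)
    have h1 := ProbabilityMeasure.tendsto_iff_tendsto_charFun.1 hclt.tendsto 1
    simp only [ProbabilityMeasure.coe_mk, hmean, mul_zero, sub_zero, Measure.map_id] at h1 ⊢
    rw [charFun_gaussianReal, hvar] at h1
    rw [charFun_multivariateGaussian hS]
    have hnn : 0 ≤ u.ofLp ⬝ᵥ S.mulVec u.ofLp := by
      rw [← hcov u]
      exact integral_nonneg fun _ => sq_nonneg _
    convert h1 using 2
    · rename_i n
      have hmeas : AEMeasurable (fun ω => (√(n : ℝ))⁻¹ • ∑ i ∈ Finset.range n, Z i ω) μ :=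
        (Finset.aemeasurable_fun_sum _ fun i _ => (hident i).aemeasurable_fst).fun_const_smul _
      have hmeas' : AEMeasurable (fun ω => (√(n : ℝ))⁻¹ * ∑ i ∈ Finset.range n, ⟪u, Z i ω⟫) μ :=
        (Finset.aemeasurable_fun_sum _ fun i _ =>
          hm.comp_aemeasurable (hident i).aemeasurable_fst).const_mul _
      rw [charFun_apply, charFun_apply, integral_map hmeas (by fun_prop),
        integral_map hmeas' (by fun_prop)]
      refine integral_congr_ae (ae_of_all _ fun ω => ?_)
      beta_reduce
      rw [real_inner_comm]
      simp [real_inner_smul_right, inner_sum]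
    · congr 1
      simp [Real.coe_toNNReal _ hnn]

end

/-! ### Asymptotic linearity of a consistent root -/

lemma tendsto_measure_zero_of_ae_eventually_notMem {Ω : Type*} [MeasurableSpace Ω]
    {μ : Measure Ω} [IsFiniteMeasure μ] {B : ℕ → Set Ω}
    (hB : ∀ n, NullMeasurableSet (B n) μ) (h : ∀ᵐ ω ∂μ, ∀ᶠ n in atTop, ω ∉ B n) :
    Tendsto (fun n => μ (B n)) atTop (𝓝 0) := by
  have h1 : Tendsto (fun n => ∫⁻ ω, (B n).indicator 1 ω ∂μ) atTop (𝓝 (∫⁻ _, 0 ∂μ)) := by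
    refine tendsto_lintegral_of_dominated_convergence' (fun _ => 1)
      (fun n => aemeasurable_one.indicator₀ (hB n))
      (fun n => ae_of_all _ fun ω => Set.indicator_le_self _ _ _) (by simp) ?_
    filter_upwards [h] with ω hω
    refine tendsto_const_nhds.congr' ?_
    filter_upwards [hω] with n hn
    simp [hn]
  simpa [lintegral_indicator_one₀ (hB _)] using h1

section

variable {Ω : Type*} [MeasurableSpace Ω] {μ : Measure Ω} [IsProbabilityMeasure μ] {p : ℕ}

/-- If a sequence of random vectors converges in distribution and `D n` differs from it by less
than any fixed multiple of its norm, with probability tending to one, then `D n` has the same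
limit. -/
theorem tendstoInDistribution_of_relative_error {Ω' : Type*} [MeasurableSpace Ω']
    {ν : Measure Ω'} [IsProbabilityMeasure ν] {Z D : ℕ → Ω → Vec p} {ζ : Ω' → Vec p}
    (hZ : TendstoInDistribution Z atTop ζ (fun _ => μ) ν) (hD : ∀ n, AEMeasurable (D n) μ)
    (h : ∀ c : ℝ, 0 < c → Tendsto (fun n => μ {ω | c * ‖Z n ω‖ < ‖D n ω - Z n ω‖}) atTop (𝓝 0)) :
    TendstoInDistribution D atTop ζ (fun _ => μ) ν := by
  refine tendstoInDistribution_of_tendstoInMeasure_sub D ζ hZ ?_ hD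
  rw [tendstoInMeasure_iff_norm]
  intro ε hε
  have hζ := hZ.aemeasurable_limit
  have hlawp : IsProbabilityMeasure (ν.map ζ) := Measure.isProbabilityMeasure_map hζ
  rw [ENNReal.tendsto_nhds_zero]
  intro τ hτ
  -- the limit law gives little mass to the complement of a large ball
  have htail : Tendsto (fun k : ℕ => (ν.map ζ) {z | (k : ℝ) ≤ ‖z‖}) atTop (𝓝 0) := by
    refine tendsto_measure_zero_of_ae_eventually_notMem (fun k => ?_) (ae_of_all _ fun z => ?_)
    · exact (measurableSet_le measurable_const measurable_norm).nullMeasurableSet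
    · filter_upwards [tendsto_natCast_atTop_atTop.eventually_gt_atTop ‖z‖] with k hk
      simpa using hk
  have hτ2 : 0 < τ / 2 := ENNReal.half_pos hτ.ne'
  obtain ⟨k, hk, hk0⟩ := ((htail.eventually_lt_const hτ2).and (eventually_gt_atTop 0)).exists
  have hk0' : (0 : ℝ) < k := by exact_mod_cast hk0
  have hport := ProbabilityMeasure.limsup_measure_closed_le_of_tendsto hZ.tendsto
    (F := {z : Vec p | (k : ℝ) ≤ ‖z‖}) (isClosed_le continuous_const continuous_norm)
  have hev := eventually_lt_of_limsup_lt (hport.trans_lt hk)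
  filter_upwards [hev, (h (ε / (2 * k)) (by positivity)).eventually_lt_const hτ2] with n h1 h2
  have h1' : μ {ω | (k : ℝ) ≤ ‖Z n ω‖} < τ / 2 := by
    simp only [ProbabilityMeasure.coe_mk] at h1
    rwa [Measure.map_apply_of_aemeasurable (hZ.forall_aemeasurable n)
      (measurableSet_le measurable_const measurable_norm)] at h1
  calc μ {ω | ε ≤ ‖(D - Z) n ω - (0 : ℕ → Ω → Vec p) n ω‖}
      ≤ μ ({ω | (k : ℝ) ≤ ‖Z n ω‖} ∪ {ω | ε / (2 * k) * ‖Z n ω‖ < ‖D n ω - Z n ω‖}) := by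
        refine measure_mono fun ω hω => ?_
        by_contra hcon
        simp only [Set.mem_union, Set.mem_ofPred_eq, not_or, not_le, not_lt] at hcon
        have h3 : ε ≤ ‖D n ω - Z n ω‖ := by simpa using hω
        have h4 : ε / (2 * k) * ‖Z n ω‖ ≤ ε / (2 * k) * k := by
          have := hcon.1.le
          gcongr
        have h5 : ε / (2 * k) * k = ε / 2 := by field_simp
        linarith [hcon.2]
    _ ≤ τ / 2 + τ / 2 := (measure_union_le _ _).trans (add_le_add h1'.le h2.le)
    _ = τ := ENNReal.add_halves τ

end

section

variable {p : ℕ}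

/-- The oscillation over the ball of radius `η` around `β₀` of the derivative of
`β ↦ g ⟪β, v⟫ • v`, where `κ = -g'`. -/
def curvOsc (κ : ℝ → ℝ) (β₀ : Vec p) (η : ℝ) (v : Vec p) : ℝ :=
  (⨆ β : Metric.closedBall β₀ η, |κ ⟪(β : Vec p), v⟫ - κ ⟪β₀, v⟫|) * ‖v‖ ^ 2

variable {g κ : ℝ → ℝ} {β₀ : Vec p} {η : ℝ}

lemma bddAbove_curvOsc (hκ : Continuous κ) (β₀ : Vec p) (η : ℝ) (v : Vec p) :
    BddAbove (Set.range fun β : Metric.closedBall β₀ η =>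
      |κ ⟪(β : Vec p), v⟫ - κ ⟪β₀, v⟫|) := by
  have : CompactSpace (Metric.closedBall β₀ η) :=
    isCompact_iff_compactSpace.1 (isCompact_closedBall _ _)
  exact (isCompact_range (by fun_prop)).bddAbove

lemma measurable_curvOsc (hκ : Continuous κ) : Measurable (curvOsc κ β₀ η) := by
  have h : Measurable fun v : Vec p =>
      ⨆ β : Metric.closedBall β₀ η, |κ ⟪(β : Vec p), v⟫ - κ ⟪β₀, v⟫| := by
    refine (lowerSemicontinuous_ciSup (bddAbove_curvOsc hκ β₀ η) fun β => ?_).measurable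
    exact Continuous.lowerSemicontinuous (by fun_prop)
  exact h.mul (by fun_prop)

lemma abs_sub_le_iSup_osc (hκ : Continuous κ) {β : Vec p} (hβ : ‖β - β₀‖ ≤ η) (v : Vec p) :
    |κ ⟪β, v⟫ - κ ⟪β₀, v⟫| ≤
      ⨆ β : Metric.closedBall β₀ η, |κ ⟪(β : Vec p), v⟫ - κ ⟪β₀, v⟫| :=
  le_ciSup (bddAbove_curvOsc hκ β₀ η v) ⟨β, by rwa [Metric.mem_closedBall, dist_eq_norm]⟩

lemma curvOsc_nonneg (κ : ℝ → ℝ) (β₀ : Vec p) (η : ℝ) (v : Vec p) : 0 ≤ curvOsc κ β₀ η v :=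
  mul_nonneg (Real.iSup_nonneg fun _ => abs_nonneg _) (sq_nonneg _)

lemma curvOsc_le {v : Vec p} {C : ℝ} (hη : 0 ≤ η)
    (h : ∀ β : Vec p, ‖β - β₀‖ ≤ η → |κ ⟪β, v⟫ - κ ⟪β₀, v⟫| * ‖v‖ ^ 2 ≤ C) :
    curvOsc κ β₀ η v ≤ C := by
  have : Nonempty (Metric.closedBall β₀ η) := ⟨⟨β₀, Metric.mem_closedBall_self hη⟩⟩
  rw [curvOsc, Real.iSup_mul_of_nonneg (sq_nonneg _)]
  refine ciSup_le fun β => h β ?_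
  rw [← dist_eq_norm]
  exact β.2

lemma norm_linearization_le (hg : ∀ t, HasDerivAt g (-κ t) t) (hκ : Continuous κ)
    {β : Vec p} (hβ : ‖β - β₀‖ ≤ η) (v : Vec p) :
    ‖g ⟪β, v⟫ • v - g ⟪β₀, v⟫ • v + (κ ⟪β₀, v⟫ * ⟪v, β - β₀⟫) • v‖ ≤
      curvOsc κ β₀ η v * ‖β - β₀‖ := by
  set M := ⨆ β : Metric.closedBall β₀ η, |κ ⟪(β : Vec p), v⟫ - κ ⟪β₀, v⟫| with hM
  have hη : 0 ≤ η := (norm_nonneg _).trans hβ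
  have hder : ∀ b ∈ Metric.closedBall β₀ η, HasFDerivWithinAt
      (fun b : Vec p => g ⟪b, v⟫ + κ ⟪β₀, v⟫ * ⟪b, v⟫)
      ((-κ ⟪b, v⟫) • innerSL ℝ v + κ ⟪β₀, v⟫ • innerSL ℝ v) (Metric.closedBall β₀ η) b :=
    fun b _ => (((hg _).comp_hasFDerivAt b (hasFDerivAt_inner_const v b)).add
      ((hasFDerivAt_inner_const v b).const_mul _)).hasFDerivWithinAt
  have hbound : ∀ b ∈ Metric.closedBall β₀ η,
      ‖(-κ ⟪b, v⟫) • innerSL ℝ v + κ ⟪β₀, v⟫ • innerSL ℝ v‖ ≤ M * ‖v‖ := by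
    intro b hb
    rw [Metric.mem_closedBall, dist_eq_norm] at hb
    rw [← add_smul, norm_smul, innerSL_apply_norm, neg_add_eq_sub, Real.norm_eq_abs, abs_sub_comm]
    gcongr
    exact abs_sub_le_iSup_osc hκ hb v
  have h := (convex_closedBall β₀ η).norm_image_sub_le_of_norm_hasFDerivWithin_le hder hbound
    (Metric.mem_closedBall_self hη) (by rwa [Metric.mem_closedBall, dist_eq_norm] : β ∈ _)
  have he : g ⟪β, v⟫ • v - g ⟪β₀, v⟫ • v + (κ ⟪β₀, v⟫ * ⟪v, β - β₀⟫) • v =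
      (g ⟪β, v⟫ + κ ⟪β₀, v⟫ * ⟪β, v⟫ - (g ⟪β₀, v⟫ + κ ⟪β₀, v⟫ * ⟪β₀, v⟫)) • v := by
    rw [← sub_smul, ← add_smul, real_inner_comm (β - β₀) v, inner_sub_left]
    congr 1
    ring
  rw [he, norm_smul]
  calc _ ≤ M * ‖v‖ * ‖β - β₀‖ * ‖v‖ := by gcongr
    _ = curvOsc κ β₀ η v * ‖β - β₀‖ := by rw [curvOsc, ← hM]; ring

lemma toEuclideanCLM_outer_apply (c : ℝ) (v d : Vec p) :
    Matrix.toEuclideanCLM (𝕜 := ℝ) (outer c v) d = (c * ⟪v, d⟫) • v := by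
  ext i
  simp only [Matrix.ofLp_toEuclideanCLM, Matrix.mulVec, dotProduct, outer, Matrix.of_apply,
    PiLp.smul_apply, smul_eq_mul, PiLp.inner_apply, RCLike.inner_apply, conj_trivial,
    Finset.mul_sum, Finset.sum_mul]
  exact Finset.sum_congr rfl fun j _ => by ring

/-- A root of the estimating equation near `β₀` agrees with its one-step linear approximation
up to a small multiple of its distance to `β₀`. -/
lemma norm_root_sub_le (hg : ∀ t, HasDerivAt g (-κ t) t) (hκ : Continuous κ)
    {H : Matrix (Fin p) (Fin p) ℝ} (hH : IsUnit H) {n : ℕ} (v : ℕ → Vec p) {β : Vec p} {ρ : ℝ}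
    (hβ : ‖β - β₀‖ ≤ η) (hroot : ∑ i ∈ Finset.range n, g ⟪β, v i⟫ • v i = 0)
    (hosc : (∑ i ∈ Finset.range n, curvOsc κ β₀ η (v i)) / n ≤ ρ)
    (hK : ‖Matrix.toEuclideanCLM (𝕜 := ℝ)
      ((n : ℝ)⁻¹ • ∑ i ∈ Finset.range n, outer (κ ⟪β₀, v i⟫) (v i) - H)‖ ≤ ρ) :
    ‖(β - β₀) - Matrix.toEuclideanCLM (𝕜 := ℝ) H⁻¹
      ((n : ℝ)⁻¹ • ∑ i ∈ Finset.range n, g ⟪β₀, v i⟫ • v i)‖ ≤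
      2 * ‖Matrix.toEuclideanCLM (𝕜 := ℝ) H⁻¹‖ * ρ * ‖β - β₀‖ := by
  set A := Matrix.toEuclideanCLM (𝕜 := ℝ) H⁻¹ with hA
  set K := (n : ℝ)⁻¹ • ∑ i ∈ Finset.range n, outer (κ ⟪β₀, v i⟫) (v i) with hKdef
  set d := β - β₀ with hd
  set s := (n : ℝ)⁻¹ • ∑ i ∈ Finset.range n, g ⟪β₀, v i⟫ • v i with hs
  have hAH : A (Matrix.toEuclideanCLM (𝕜 := ℝ) H d) = d := by
    rw [← ContinuousLinearMap.comp_apply, ← ContinuousLinearMap.mul_def, hA, ← map_mul,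
      Matrix.nonsing_inv_mul _ ((Matrix.isUnit_iff_isUnit_det _).1 hH), map_one]
    rfl
  have hKd : Matrix.toEuclideanCLM (𝕜 := ℝ) K d =
      (n : ℝ)⁻¹ • ∑ i ∈ Finset.range n, (κ ⟪β₀, v i⟫ * ⟪v i, d⟫) • v i := by
    rw [hKdef, map_smul, map_sum, smul_apply, sum_apply]
    simp_rw [toEuclideanCLM_outer_apply]
  have hr : ‖Matrix.toEuclideanCLM (𝕜 := ℝ) K d - s‖ ≤ ρ * ‖d‖ := by
    have he : Matrix.toEuclideanCLM (𝕜 := ℝ) K d - s = (n : ℝ)⁻¹ • ∑ i ∈ Finset.range n,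
        (g ⟪β, v i⟫ • v i - g ⟪β₀, v i⟫ • v i + (κ ⟪β₀, v i⟫ * ⟪v i, d⟫) • v i) := by
      rw [hKd, hs, Finset.sum_add_distrib, Finset.sum_sub_distrib, hroot, smul_add, zero_sub,
        smul_neg]
      abel
    rw [he, norm_smul, norm_inv, RCLike.norm_natCast]
    calc _ ≤ (n : ℝ)⁻¹ * ∑ i ∈ Finset.range n, curvOsc κ β₀ η (v i) * ‖d‖ := by
          gcongr
          exact (norm_sum_le _ _).trans
            (Finset.sum_le_sum fun i _ => norm_linearization_le hg hκ hβ (v i))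
      _ = (∑ i ∈ Finset.range n, curvOsc κ β₀ η (v i)) / n * ‖d‖ := by
          rw [← Finset.sum_mul]; ring
      _ ≤ ρ * ‖d‖ := by gcongr
  have hfin : d - A s = A ((Matrix.toEuclideanCLM (𝕜 := ℝ) K d - s) -
      Matrix.toEuclideanCLM (𝕜 := ℝ) (K - H) d) := by
    rw [map_sub (Matrix.toEuclideanCLM (𝕜 := ℝ)), sub_apply, map_sub A, map_sub A, map_sub A, hAH]
    abel
  rw [hfin]
  calc _ ≤ ‖A‖ * (ρ * ‖d‖ + ρ * ‖d‖) := by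
        refine (A.le_opNorm _).trans ?_
        gcongr
        refine (norm_sub_le _ _).trans (add_le_add hr ?_)
        refine (ContinuousLinearMap.le_opNorm _ _).trans ?_
        gcongr
    _ = _ := by ring

end

section

variable {Ω : Type*} [MeasurableSpace Ω] {μ : Measure Ω} {p : ℕ} {g κ : ℝ → ℝ} {β₀ : Vec p}

/-- A dominated derivative has, on average, small oscillation over small balls. -/
lemma exists_integral_curvOsc_lt (hκ : Continuous κ) {V : Ω → Vec p} (hV : Measurable V)
    {r : ℝ} (hr : 0 < r) {D : Ω → ℝ} (hD : Integrable D μ)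
    (hdom : ∀ᵐ ω ∂μ, ∀ β : Vec p, ‖β - β₀‖ ≤ r → |κ ⟪β, V ω⟫| * ‖V ω‖ ^ 2 ≤ D ω)
    {ρ : ℝ} (hρ : 0 < ρ) :
    ∃ η, 0 < η ∧ Integrable (fun ω => curvOsc κ β₀ η (V ω)) μ ∧
      ∫ ω, curvOsc κ β₀ η (V ω) ∂μ < ρ := by
  set η : ℕ → ℝ := fun k => r / (k + 1) with hη
  have hη0 : ∀ k, 0 < η k := fun k => by positivity
  have hηr : ∀ k, η k ≤ r := fun k => div_le_self hr.le (by simp)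
  have hηlim : Tendsto η atTop (𝓝 0) := by
    have := (tendsto_one_div_add_atTop_nhds_zero_nat (𝕜 := ℝ)).const_mul r
    simpa [hη, div_eq_mul_inv] using this
  have hm : ∀ k, AEStronglyMeasurable (fun ω => curvOsc κ β₀ (η k) (V ω)) μ := fun k =>
    ((measurable_curvOsc hκ).comp hV).aestronglyMeasurable
  have hb : ∀ k, ∀ᵐ ω ∂μ, ‖curvOsc κ β₀ (η k) (V ω)‖ ≤ 2 * D ω := fun k => by
    filter_upwards [hdom] with ω hω
    rw [Real.norm_of_nonneg (curvOsc_nonneg _ _ _ _)]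
    refine curvOsc_le (hη0 k).le fun β hβ => ?_
    have h1 := hω β (hβ.trans (hηr k))
    have h2 := hω β₀ (by simpa using hr.le)
    calc |κ ⟪β, V ω⟫ - κ ⟪β₀, V ω⟫| * ‖V ω‖ ^ 2
        ≤ (|κ ⟪β, V ω⟫| + |κ ⟪β₀, V ω⟫|) * ‖V ω‖ ^ 2 := by gcongr; exact abs_sub _ _
      _ ≤ 2 * D ω := by linarith
  have hlim : ∀ v : Vec p, Tendsto (fun k => curvOsc κ β₀ (η k) v) atTop (𝓝 0) := by
    intro v
    have hc : ContinuousAt (fun β : Vec p => |κ ⟪β, v⟫ - κ ⟪β₀, v⟫| * ‖v‖ ^ 2) β₀ :=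
      Continuous.continuousAt (by fun_prop)
    rw [Metric.tendsto_atTop]
    intro ε hε
    obtain ⟨s, hs, hsε⟩ := Metric.continuousAt_iff.1 hc (ε / 2) (by positivity)
    obtain ⟨N, hN⟩ := eventually_atTop.1 (hηlim.eventually_lt_const hs)
    refine ⟨N, fun k hk => ?_⟩
    rw [Real.dist_0_eq_abs, abs_of_nonneg (curvOsc_nonneg _ _ _ _)]
    refine lt_of_le_of_lt (curvOsc_le (hη0 k).le fun β hβ => ?_) (half_lt_self hε)
    have h1 := hsε (x := β) (by rw [dist_eq_norm]; exact hβ.trans_lt (hN k hk))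
    simp only [sub_self, abs_zero, zero_mul, Real.dist_0_eq_abs] at h1
    exact (le_abs_self _).trans h1.le
  have hconv := tendsto_integral_of_dominated_convergence (fun ω => 2 * D ω) hm (hD.const_mul 2)
    hb (ae_of_all _ fun ω => hlim (V ω))
  rw [integral_zero] at hconv
  obtain ⟨k, hk⟩ := (hconv.eventually_lt_const hρ).exists
  exact ⟨η k, hη0 k, (hD.const_mul 2).mono' (hm k) (hb k), hk⟩

/-- A consistent sequence of approximate roots of `∑ g ⟪β, Vᵢ⟫ • Vᵢ = 0` is, up to an error that is
small relative to it, the normalized sum of the influence functions. -/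
theorem tendsto_measure_relative_error [IsProbabilityMeasure μ] {V : ℕ → Ω → Vec p}
    (hVm : ∀ i, Measurable (V i)) (hindep : iIndepFun V μ)
    (hident : ∀ i, IdentDistrib (V i) (V 0) μ μ)
    (hg : ∀ t, HasDerivAt g (-κ t) t) (hκ : Continuous κ)
    {H : Matrix (Fin p) (Fin p) ℝ} (hH : IsUnit H)
    (hHi : HasMean μ fun ω => outer (κ ⟪β₀, V 0 ω⟫) (V 0 ω))
    (hHm : mean μ (fun ω => outer (κ ⟪β₀, V 0 ω⟫) (V 0 ω)) = H)
    {r : ℝ} (hr : 0 < r) {D : Ω → ℝ} (hD : Integrable D μ)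
    (hdom : ∀ᵐ ω ∂μ, ∀ β : Vec p, ‖β - β₀‖ ≤ r → |κ ⟪β, V 0 ω⟫| * ‖V 0 ω‖ ^ 2 ≤ D ω)
    {βhat : ℕ → Ω → Vec p}
    (hcons : ∀ ε : ℝ, 0 < ε → Tendsto (fun n => μ {ω | ε ≤ ‖βhat n ω - β₀‖}) atTop (𝓝 0))
    (hroot : Tendsto (fun n => μ {ω | ∑ i ∈ Finset.range n, g ⟪βhat n ω, V i ω⟫ • V i ω ≠ 0})
      atTop (𝓝 0)) {c : ℝ} (hc : 0 < c) :
    Tendsto (fun n : ℕ => μ {ω | c * ‖(√(n : ℝ))⁻¹ • ∑ i ∈ Finset.range n,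
          Matrix.toEuclideanCLM (𝕜 := ℝ) H⁻¹ (g ⟪β₀, V i ω⟫ • V i ω)‖ <
        ‖√(n : ℝ) • (βhat n ω - β₀) - (√(n : ℝ))⁻¹ • ∑ i ∈ Finset.range n,
          Matrix.toEuclideanCLM (𝕜 := ℝ) H⁻¹ (g ⟪β₀, V i ω⟫ • V i ω)‖}) atTop (𝓝 0) := by
  set A := Matrix.toEuclideanCLM (𝕜 := ℝ) H⁻¹ with hA
  -- the tolerance `ρ` makes `q = 2 ‖A‖ ρ` satisfy `q ≤ 1 / 2` and `2 q ≤ c`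
  obtain ⟨ρ, hρ, hρ1, hρ2⟩ : ∃ ρ : ℝ, 0 < ρ ∧ 2 * ‖A‖ * ρ ≤ 1 / 2 ∧ 2 * (2 * ‖A‖ * ρ) ≤ c := by
    have h : 2 * ‖A‖ * (min (1 / 2) (c / 2) / (2 * ‖A‖ + 1)) ≤ min (1 / 2) (c / 2) := by
      rw [← mul_div_assoc, div_le_iff₀ (by positivity)]
      have : 0 < min (1 / 2) (c / 2) := by positivity
      nlinarith
    refine ⟨min (1 / 2) (c / 2) / (2 * ‖A‖ + 1), by positivity, h.trans (min_le_left _ _), ?_⟩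
    linarith [h.trans (min_le_right _ _)]
  obtain ⟨η, hη, hoi, hoρ⟩ := exists_integral_curvOsc_lt hκ (hVm 0) hr hD hdom hρ
  set B1 : ℕ → Set Ω := fun n =>
    {ω | ¬ (∑ i ∈ Finset.range n, curvOsc κ β₀ η (V i ω)) / n < ρ} with hB1
  set B2 : ℕ → Set Ω := fun n => {ω | ¬ ‖Matrix.toEuclideanCLM (𝕜 := ℝ)
      ((n : ℝ)⁻¹ • ∑ i ∈ Finset.range n, outer (κ ⟪β₀, V i ω⟫) (V i ω) - H)‖ < ρ} with hB2
  have hclm : Continuous fun M : Matrix (Fin p) (Fin p) ℝ =>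
      ‖Matrix.toEuclideanCLM (𝕜 := ℝ) M‖ :=
    (LinearMap.continuous_of_finiteDimensional
      { toFun := Matrix.toEuclideanCLM (n := Fin p) (𝕜 := ℝ)
        map_add' := map_add _
        map_smul' := map_smul _ }).norm
  have hB1lim : Tendsto (fun n => μ (B1 n)) atTop (𝓝 0) := by
    refine tendsto_measure_zero_of_ae_eventually_notMem (fun n => ?_) ?_
    · have : Measurable fun ω => (∑ i ∈ Finset.range n, curvOsc κ β₀ η (V i ω)) / n :=
        (Finset.measurable_fun_sum _ fun i _ => (measurable_curvOsc hκ).comp (hVm i)).div_const _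
      exact (measurableSet_lt this measurable_const).compl.nullMeasurableSet
    · filter_upwards [ae_tendsto_sum_comp_div hindep hident (measurable_curvOsc hκ) hoi] with ω hω
      filter_upwards [hω.eventually_lt_const hoρ] with n hn
      simpa [hB1] using hn
  have hm : ∀ i j, Measurable fun v : Vec p => outer (κ ⟪β₀, v⟫) v i j := fun i j => by
    simp only [outer, Matrix.of_apply]
    exact Continuous.measurable (by fun_prop)
  have hB2lim : Tendsto (fun n => μ (B2 n)) atTop (𝓝 0) := by
    refine tendsto_measure_zero_of_ae_eventually_notMem (fun n => ?_) ?_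
    · have h1 : Measurable fun ω => (fun i j => ((n : ℝ)⁻¹ •
          ∑ k ∈ Finset.range n, outer (κ ⟪β₀, V k ω⟫) (V k ω) - H) i j : Fin p → Fin p → ℝ) := by
        refine measurable_pi_lambda _ fun i => measurable_pi_lambda _ fun j => ?_
        simp only [Matrix.sub_apply, Matrix.smul_apply, Matrix.sum_apply, smul_eq_mul]
        have hs := Finset.measurable_fun_sum (Finset.range n) fun k _ => (hm i j).comp (hVm k)
        exact (hs.const_mul _).sub_const _
      have h2' : Continuous fun M : Fin p → Fin p → ℝ =>
          ‖Matrix.toEuclideanCLM (𝕜 := ℝ) (Matrix.of M)‖ := hclm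
      have h2 := h2'.measurable
      exact (measurableSet_lt (h2.comp h1) measurable_const).compl.nullMeasurableSet
    · have hij : ∀ᵐ ω ∂μ, ∀ i j, Tendsto (fun n : ℕ =>
          (∑ k ∈ Finset.range n, outer (κ ⟪β₀, V k ω⟫) (V k ω) i j) / n) atTop (𝓝 (H i j)) := by
        refine ae_all_iff.2 fun i => ae_all_iff.2 fun j => ?_
        have := ae_tendsto_sum_comp_div hindep hident (hm i j) (hHi i j)
        rw [← hHm]
        exact this
      filter_upwards [hij] with ω hω
      have hmat : Tendsto (fun n : ℕ => (n : ℝ)⁻¹ •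
          ∑ k ∈ Finset.range n, outer (κ ⟪β₀, V k ω⟫) (V k ω) - H) atTop (𝓝 0) := by
        refine tendsto_pi_nhds.2 fun i => tendsto_pi_nhds.2 fun j => ?_
        have h := (hω i j).sub_const (H i j)
        rw [sub_self] at h
        refine h.congr fun n => ?_
        simp only [Matrix.sub_apply, Matrix.smul_apply, Matrix.sum_apply, smul_eq_mul]
        ring
      have hnorm := (hclm.tendsto 0).comp hmat
      simp only [map_zero, norm_zero] at hnorm
      filter_upwards [hnorm.eventually_lt_const hρ] with n hn
      simpa [hB2] using hn
  have hsum : Tendsto (fun n => μ {ω | η ≤ ‖βhat n ω - β₀‖} +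
      μ {ω | ∑ i ∈ Finset.range n, g ⟪βhat n ω, V i ω⟫ • V i ω ≠ 0} + μ (B1 n) + μ (B2 n))
      atTop (𝓝 0) := by
    simpa using (((hcons η hη).add hroot).add hB1lim).add hB2lim
  refine tendsto_of_tendsto_of_tendsto_of_le_of_le' tendsto_const_nhds hsum
    (Eventually.of_forall fun _ => zero_le) ?_
  filter_upwards [eventually_gt_atTop 0] with n hn
  refine le_trans (measure_mono fun ω hω => ?_) ((measure_union_le
    ({ω | η ≤ ‖βhat n ω - β₀‖} ∪
      {ω | ∑ i ∈ Finset.range n, g ⟪βhat n ω, V i ω⟫ • V i ω ≠ 0} ∪ B1 n) (B2 n)).trans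
    (add_le_add_left ((measure_union_le _ _).trans
      (add_le_add_left (measure_union_le _ _) _)) _))
  by_contra hcon
  simp only [Set.mem_union, not_or, hB1, hB2, Set.mem_ofPred_eq, not_not, not_le] at hcon
  obtain ⟨⟨⟨h1, h2⟩, h3⟩, h4⟩ := hcon
  have hdet := norm_root_sub_le hg hκ hH (fun i => V i ω) h1.le h2 h3.le h4.le
  rw [← hA] at hdet
  have hn0 : (0 : ℝ) < √(n : ℝ) := Real.sqrt_pos.2 (by exact_mod_cast hn)
  set d := βhat n ω - β₀
  set Zn := (√(n : ℝ))⁻¹ • ∑ i ∈ Finset.range n, A (g ⟪β₀, V i ω⟫ • V i ω) with hZn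
  have hZ : Zn = √(n : ℝ) • A ((n : ℝ)⁻¹ • ∑ i ∈ Finset.range n, g ⟪β₀, V i ω⟫ • V i ω) := by
    rw [hZn, map_smul, map_sum, smul_smul]
    congr 1
    have hsq : √(n : ℝ) * √(n : ℝ) = n := Real.mul_self_sqrt (Nat.cast_nonneg n)
    nth_rewrite 3 [← hsq]
    field_simp
  have h5 : ‖√(n : ℝ) • d - Zn‖ ≤ 2 * ‖A‖ * ρ * ‖√(n : ℝ) • d‖ := by
    rw [hZ, ← smul_sub, norm_smul, norm_smul]
    calc _ ≤ ‖√(n : ℝ)‖ * (2 * ‖A‖ * ρ * ‖d‖) := by gcongr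
      _ = _ := by ring
  have h6 : ‖√(n : ℝ) • d‖ ≤ ‖√(n : ℝ) • d - Zn‖ + ‖Zn‖ := by
    simpa using norm_add_le (√(n : ℝ) • d - Zn) Zn
  have h7 : c * ‖Zn‖ < ‖√(n : ℝ) • d - Zn‖ := hω
  have h8 := norm_nonneg (√(n : ℝ) • d)
  have h9 := norm_nonneg Zn
  have h10 : 2 * ‖A‖ * ρ * ‖√(n : ℝ) • d‖ ≤ 1 / 2 * ‖√(n : ℝ) • d‖ := by gcongr
  have h11 : ‖√(n : ℝ) • d‖ ≤ 2 * ‖Zn‖ := by linarith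
  have h12 : 2 * ‖A‖ * ρ * ‖√(n : ℝ) • d‖ ≤ 2 * ‖A‖ * ρ * (2 * ‖Zn‖) := by gcongr
  have h13 : 2 * (2 * ‖A‖ * ρ) * ‖Zn‖ ≤ c * ‖Zn‖ := by gcongr
  linarith

end

/-! ### Domination -/

lemma sq_mul_exp_neg_le {b : ℝ} (hb : 0 < b) {x : ℝ} (hx : 0 ≤ x) :
    Real.exp (-(b * x)) * x ^ 2 ≤ 2 / b ^ 2 := by
  have h := Real.quadratic_le_exp_of_nonneg (mul_nonneg hb.le hx)
  have h1 : b * x * (b * x) / 2 ≤ Real.exp (b * x) := by nlinarith [mul_nonneg hb.le hx]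
  rw [Real.exp_neg, inv_mul_eq_div, div_le_div_iff₀ (Real.exp_pos _) (by positivity)]
  nlinarith

/-- A bound on the squared score over a ball of parameters controls its derivative over a smaller
ball: either some parameter of the ball is orthogonal to `v`, where the score has size `‖v‖`, or
the margin is at least of order `‖v‖` and the derivative is exponentially small. -/
lemma exists_exp_neg_margin_mul_sq_le {p : ℕ} {γ δ : ℝ} (hγ : 0 < γ) (hδ : 0 < δ) (β₀ : Vec p) :
    ∃ C : ℝ, 0 < C ∧ ∀ (v : Vec p) (G : ℝ),
      (∀ β : Vec p, ‖β - β₀‖ < δ → marginScore γ ⟪β, v⟫ ^ 2 * ‖v‖ ^ 2 ≤ G) →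
      ∀ β : Vec p, ‖β - β₀‖ ≤ δ / 2 → Real.exp (-(γ * |⟪β, v⟫|)) * ‖v‖ ^ 2 ≤ C * (G + 1) := by
  have hs := marginScore_pos γ 0
  refine ⟨1 / marginScore γ 0 ^ 2 + 2 / (γ * (δ / 2)) ^ 2, by positivity, fun v G hG β hβ => ?_⟩
  have hG0 : 0 ≤ G := le_trans (by positivity) (hG β₀ (by simpa using hδ))
  have hmono1 : G / marginScore γ 0 ^ 2 ≤
      (1 / marginScore γ 0 ^ 2 + 2 / (γ * (δ / 2)) ^ 2) * (G + 1) := by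
    rw [div_eq_mul_one_div, mul_comm]
    gcongr
    · have : 0 ≤ 2 / (γ * (δ / 2)) ^ 2 := by positivity
      linarith
    · linarith
  have hmono2 : 2 / (γ * (δ / 2)) ^ 2 ≤
      (1 / marginScore γ 0 ^ 2 + 2 / (γ * (δ / 2)) ^ 2) * (G + 1) := by
    have h1 : 0 ≤ 1 / marginScore γ 0 ^ 2 := by positivity
    have h2 : 0 ≤ 2 / (γ * (δ / 2)) ^ 2 := by positivity
    nlinarith
  rcases lt_or_ge |⟪β, v⟫| (δ / 2 * ‖v‖) with h | h
  · have hv : 0 < ‖v‖ := by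
      by_contra hv
      have : ‖v‖ = 0 := le_antisymm (not_lt.1 hv) (norm_nonneg v)
      rw [this, mul_zero] at h
      exact absurd h (not_lt.2 (abs_nonneg _))
    -- the projection of `β` on the hyperplane orthogonal to `v` is still in the ball
    set β' := β - (⟪β, v⟫ / ‖v‖ ^ 2) • v with hβ'
    have hin : ⟪β', v⟫ = 0 := by
      rw [hβ', inner_sub_left, real_inner_smul_left, real_inner_self_eq_norm_sq]
      field_simp
      ring
    have hdist : ‖β' - β‖ < δ / 2 := by
      rw [hβ', sub_sub_cancel_left, norm_neg, norm_smul, norm_div, Real.norm_eq_abs, norm_pow,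
        norm_norm]
      calc |⟪β, v⟫| / ‖v‖ ^ 2 * ‖v‖ = |⟪β, v⟫| / ‖v‖ := by field_simp
        _ < δ / 2 := by rwa [div_lt_iff₀ hv]
    have h1 := hG β' (by
      calc ‖β' - β₀‖ = ‖(β' - β) + (β - β₀)‖ := by rw [sub_add_sub_cancel]
        _ ≤ ‖β' - β‖ + ‖β - β₀‖ := norm_add_le _ _
        _ < δ := by linarith)
    rw [hin] at h1
    refine le_trans ?_ hmono1
    rw [le_div_iff₀ (by positivity)]
    calc Real.exp (-(γ * |⟪β, v⟫|)) * ‖v‖ ^ 2 * marginScore γ 0 ^ 2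
        ≤ 1 * ‖v‖ ^ 2 * marginScore γ 0 ^ 2 := by
          gcongr
          exact Real.exp_le_one_iff.2 (by have := abs_nonneg ⟪β, v⟫; nlinarith)
      _ ≤ G := by linarith
  · refine le_trans ?_ hmono2
    refine le_trans ?_ (sq_mul_exp_neg_le (b := γ * (δ / 2)) (by positivity) (norm_nonneg v))
    have h1 : γ * (δ / 2) * ‖v‖ ≤ γ * |⟪β, v⟫| := by
      rw [mul_assoc]
      gcongr
    gcongr

/-! ### The matrices of the limit law -/

lemma abs_outer_le {p : ℕ} (c : ℝ) (x : Vec p) (i j : Fin p) :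
    |outer c x i j| ≤ |c| * ‖x‖ ^ 2 := by
  rw [outer, Matrix.of_apply, abs_mul, abs_mul, sq]
  gcongr
  · exact PiLp.norm_apply_le x i
  · exact PiLp.norm_apply_le x j

lemma measurable_outer {p : ℕ} {c : Vec p → ℝ} (hc : Measurable c) (i j : Fin p) :
    Measurable fun x : Vec p => outer (c x) x i j := by
  simp only [outer, Matrix.of_apply]
  exact hc.mul (Continuous.measurable (by fun_prop))

/-- The factor of `hInt`, before averaging over the label. -/
def hFactor (γ t : ℝ) : ℝ := marginScore γ t * Real.sigmoid ((γ + 1) * t)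

/-- The factor of `deltaInt`. -/
def deltaFactor (γ t : ℝ) : ℝ :=
  γ * (marginScore γ t * (2 * Real.sigmoid ((γ + 1) * t) - 1))

section

variable {p : ℕ} {γ : ℝ}

lemma marginCurv_eq_add (γ t : ℝ) : marginCurv γ t = hFactor γ t + deltaFactor γ t := by
  rw [marginCurv, hFactor, deltaFactor]
  ring

lemma continuous_hFactor (hγ : 0 < γ) : Continuous (hFactor γ) := by
  unfold hFactor
  exact (continuous_marginScore hγ).mul (continuous_sigmoid.comp (by fun_prop))

lemma continuous_deltaFactor (hγ : 0 < γ) : Continuous (deltaFactor γ) := by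
  unfold deltaFactor
  exact continuous_const.mul ((continuous_marginScore hγ).mul
    ((continuous_const.mul (continuous_sigmoid.comp (by fun_prop))).sub continuous_const))

lemma hFactor_nonneg (γ t : ℝ) : 0 ≤ hFactor γ t :=
  mul_nonneg (marginScore_pos γ t).le (Real.sigmoid_nonneg _)

lemma abs_hFactor_le (hγ : 0 < γ) (t : ℝ) : |hFactor γ t| ≤ 1 * Real.exp (-(γ * |t|)) := by
  rw [abs_of_nonneg (hFactor_nonneg γ t), hFactor, mul_comm]
  exact mul_le_mul (Real.sigmoid_le_one _) (marginScore_le_exp hγ t) (marginScore_pos γ t).le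
    zero_le_one

lemma abs_deltaFactor_le (hγ : 0 < γ) (t : ℝ) : |deltaFactor γ t| ≤ γ * Real.exp (-(γ * |t|)) := by
  rw [deltaFactor, abs_mul, abs_of_pos hγ, abs_mul, abs_of_pos (marginScore_pos γ t)]
  have h0 := Real.sigmoid_nonneg ((γ + 1) * t)
  have h1 := Real.sigmoid_le_one ((γ + 1) * t)
  have h2 : |2 * Real.sigmoid ((γ + 1) * t) - 1| ≤ 1 := by
    rw [abs_le]
    constructor <;> linarith
  gcongr
  calc _ ≤ marginScore γ t * 1 := by have := (marginScore_pos γ t).le; gcongr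
    _ ≤ _ := by rw [mul_one]; exact marginScore_le_exp hγ t

lemma abs_marginScore_sq_le (hγ : 0 < γ) (t : ℝ) :
    |marginScore γ t ^ 2| ≤ 1 * Real.exp (-(γ * |t|)) := by
  have h0 := (marginScore_pos γ t).le
  have h1 := marginScore_le_exp hγ t
  have h2 : Real.exp (-(γ * |t|)) ≤ 1 :=
    Real.exp_le_one_iff.2 (by have := abs_nonneg t; nlinarith)
  rw [abs_of_nonneg (sq_nonneg _)]
  nlinarith

lemma hInt_eq (hγ : 0 < γ) (β x : Vec p) :
    hInt γ β x = outer (Real.sigmoid ⟪β, x⟫ * hFactor γ ⟪β, x⟫ +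
      (1 - Real.sigmoid ⟪β, x⟫) * hFactor γ ⟪β, -x⟫) x := by
  rw [hInt, pmfNorm, prob_eq_sigmoid, ← sigmoid_mul_marginWeight_add hγ, nu, prob_smul_eq_sigmoid]
  congr 1
  rw [inner_neg_right, hFactor, hFactor, marginScore_neg, marginScore, mul_neg, Real.sigmoid_neg]
  ring

lemma uInt_eq {y : ℝ} (hy : y = 0 ∨ y = 1) (β x : Vec p) :
    uInt γ β x y = outer (marginScore γ ⟪β, signed x y⟫ ^ 2) (signed x y) := by
  rw [uInt, score_coeff_sq hy, outer_signed hy]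

lemma deltaInt_eq {y : ℝ} (hy : y = 0 ∨ y = 1) (β x : Vec p) :
    deltaInt γ β x y = outer (deltaFactor γ ⟪β, signed x y⟫) (signed x y) := by
  rw [outer_signed hy, deltaInt, weight_eq hy, nu, prob_smul_eq_sigmoid]
  congr 1
  rcases hy with rfl | rfl
  · rw [signed_zero, inner_neg_right, deltaFactor, marginScore_neg, mul_neg, Real.sigmoid_neg]
    ring
  · rw [signed_one, deltaFactor, marginScore]
    ring

lemma sigmoid_mul_deltaFactor_add (hγ : 0 < γ) (t : ℝ) :
    Real.sigmoid t * deltaFactor γ t + (1 - Real.sigmoid t) * deltaFactor γ (-t) = 0 := by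
  rw [deltaFactor, deltaFactor, mul_neg, Real.sigmoid_neg]
  linear_combination (γ * (2 * Real.sigmoid ((γ + 1) * t) - 1)) * sigmoid_mul_marginScore hγ t

end

section

variable {Ω : Type*} [MeasurableSpace Ω] {μ : Measure Ω} {p : ℕ} {γ : ℝ} {β₀ : Vec p}

lemma hasMean_outer {c : ℝ → ℝ} (hc : Continuous c) {M : ℝ}
    (hM : ∀ t, |c t| ≤ M * Real.exp (-(γ * |t|))) {Z : Ω → Vec p} (hZ : Measurable Z)
    {D : Ω → ℝ} (hD : Integrable D μ)
    (hdom : ∀ᵐ ω ∂μ, Real.exp (-(γ * |⟪β₀, Z ω⟫|)) * ‖Z ω‖ ^ 2 ≤ D ω) :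
    HasMean μ fun ω => outer (c ⟪β₀, Z ω⟫) (Z ω) := by
  intro i j
  have hM0 : 0 ≤ M := by
    have := (abs_nonneg _).trans (hM 0)
    simpa using this
  refine (hD.const_mul M).mono' (Measurable.aestronglyMeasurable ?_) ?_
  · exact (measurable_outer (c := fun x => c ⟪β₀, x⟫)
      (Continuous.measurable (by fun_prop)) i j).comp hZ
  · filter_upwards [hdom] with ω hω
    calc ‖outer (c ⟪β₀, Z ω⟫) (Z ω) i j‖ ≤ |c ⟪β₀, Z ω⟫| * ‖Z ω‖ ^ 2 := abs_outer_le _ _ _ _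
      _ ≤ M * Real.exp (-(γ * |⟪β₀, Z ω⟫|)) * ‖Z ω‖ ^ 2 := by gcongr; exact hM _
      _ ≤ M * D ω := by rw [mul_assoc]; gcongr

lemma integral_mul_inner_mul {c : Ω → ℝ} {Z : Ω → Vec p}
    (h : HasMean μ fun ω => outer (c ω) (Z ω)) (w : Vec p) (i : Fin p) :
    ∫ ω, c ω * (Z ω i * ⟪w, Z ω⟫) ∂μ = (mean μ fun ω => outer (c ω) (Z ω)).mulVec w.ofLp i := by
  simp only [Matrix.mulVec, dotProduct, mean, Matrix.of_apply]
  simp_rw [← integral_mul_const]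
  rw [← integral_finsetSum _ fun j _ => (h i j).mul_const _]
  refine integral_congr_ae (ae_of_all _ fun ω => ?_)
  simp only [PiLp.inner_apply, RCLike.inner_apply, conj_trivial, outer, Matrix.of_apply,
    Finset.mul_sum]
  exact Finset.sum_congr rfl fun j _ => by ring

lemma integral_mul_inner_sq {c : Ω → ℝ} {Z : Ω → Vec p}
    (h : HasMean μ fun ω => outer (c ω) (Z ω)) (w : Vec p) :
    ∫ ω, c ω * ⟪w, Z ω⟫ ^ 2 ∂μ =
      w.ofLp ⬝ᵥ (mean μ fun ω => outer (c ω) (Z ω)).mulVec w.ofLp := by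
  have hi : ∀ i, Integrable (fun ω => w i * (c ω * (Z ω i * ⟪w, Z ω⟫))) μ := fun i => by
    have : (fun ω => w i * (c ω * (Z ω i * ⟪w, Z ω⟫))) =
        fun ω => ∑ j, w i * w j * outer (c ω) (Z ω) i j := by
      ext ω
      simp only [PiLp.inner_apply, RCLike.inner_apply, conj_trivial, outer, Matrix.of_apply,
        Finset.mul_sum]
      exact Finset.sum_congr rfl fun j _ => by ring
    rw [this]
    exact integrable_finsetSum _ fun j _ => (h i j).const_mul _
  simp only [dotProduct, ← integral_mul_inner_mul h, ← integral_const_mul]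
  rw [← integral_finsetSum _ fun i _ => hi i]
  refine integral_congr_ae (ae_of_all _ fun ω => ?_)
  change c ω * ⟪w, Z ω⟫ ^ 2 = ∑ i, w i * (c ω * (Z ω i * ⟪w, Z ω⟫))
  rw [sq, ← mul_assoc]
  nth_rewrite 1 [PiLp.inner_apply]
  simp only [RCLike.inner_apply, conj_trivial, Finset.mul_sum, Finset.sum_mul]
  exact Finset.sum_congr rfl fun i _ => by ring

lemma transpose_mean_outer (c : Ω → ℝ) (Z : Ω → Vec p) :
    (mean μ fun ω => outer (c ω) (Z ω)).transpose = mean μ fun ω => outer (c ω) (Z ω) := by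
  ext i j
  simp only [mean, outer, Matrix.transpose_apply, Matrix.of_apply]
  refine integral_congr_ae (ae_of_all _ fun ω => ?_)
  ring

/-- If the weighted second moment matrix of `Z` is invertible, `Z` does not lie in a proper
subspace. -/
lemma eq_top_of_isUnit_mean_outer {c : Ω → ℝ} {Z : Ω → Vec p}
    (h : HasMean μ fun ω => outer (c ω) (Z ω))
    (hu : IsUnit (mean μ fun ω => outer (c ω) (Z ω))) (W : Submodule ℝ (Vec p))
    (hW : ∀ᵐ ω ∂μ, Z ω ∈ W) : W = ⊤ := by
  rw [← Submodule.orthogonal_eq_bot_iff, Submodule.eq_bot_iff]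
  intro u huW
  have h0 : (mean μ fun ω => outer (c ω) (Z ω)).mulVec u.ofLp = 0 := by
    ext i
    rw [← integral_mul_inner_mul h u i, Pi.zero_apply]
    refine integral_eq_zero_of_ae ?_
    filter_upwards [hW] with ω hω
    have : ⟪u, Z ω⟫ = 0 := (Submodule.mem_orthogonal' W u).1 huW _ hω
    simp [this]
  have h1 := Matrix.mulVec_injective_iff_isUnit.2 hu (h0.trans (Matrix.mulVec_zero _).symm)
  ext i
  exact congrFun h1 i

end

/-! ### The estimator -/

section

variable {p : ℕ} {γ : ℝ}

lemma criterion_eq (hγ : 0 < γ) (n : ℕ) (x : ℕ → Vec p) {y : ℕ → ℝ}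
    (hy : ∀ i, y i = 0 ∨ y i = 1) (β : Vec p) :
    criterion γ n x y β =
      (1 / (n : ℝ)) * ∑ i ∈ Finset.range n, marginWeight γ ⟪β, signed (x i) (y i)⟫ := by
  simp only [criterion, criterion_summand_eq hγ (hy _)]

lemma estFun_eq (n : ℕ) (x : ℕ → Vec p) {y : ℕ → ℝ} (hy : ∀ i, y i = 0 ∨ y i = 1) (β : Vec p) :
    estFun γ n x y β = (1 / (n : ℝ)) • ∑ i ∈ Finset.range n,
      marginScore γ ⟪β, signed (x i) (y i)⟫ • signed (x i) (y i) := by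
  simp only [estFun, score_eq (hy _)]

/-- The estimating equation is the first-order condition of the criterion. -/
lemma estFun_eq_zero_of_isMaxOn (hγ : 0 < γ) {n : ℕ} {x : ℕ → Vec p} {y : ℕ → ℝ}
    (hy : ∀ i, y i = 0 ∨ y i = 1) {β : Vec p} (h : IsMaxOn (criterion γ n x y) Set.univ β) :
    estFun γ n x y β = 0 := by
  have hd : HasFDerivAt (criterion γ n x y)
      ((1 / (n : ℝ)) • ∑ i ∈ Finset.range n,
        (γ * marginScore γ ⟪β, signed (x i) (y i)⟫) • innerSL ℝ (signed (x i) (y i))) β := by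
    rw [funext (criterion_eq hγ n x hy)]
    exact (HasFDerivAt.fun_sum fun i _ => hasFDerivAt_marginWeight_inner hγ _ β).const_mul _
  have h0 := (h.isLocalMax univ_mem).hasFDerivAt_eq_zero hd
  have h1 : γ • estFun γ n x y β = 0 := by
    rw [← inner_self_eq_zero (𝕜 := ℝ)]
    have h2 := congrArg (fun L : Vec p →L[ℝ] ℝ => L (γ • estFun γ n x y β)) h0
    simp only [smul_apply, sum_apply, innerSL_apply_apply, zero_apply, smul_eq_mul] at h2
    nth_rewrite 1 [estFun_eq n x hy]
    rw [← h2, Finset.smul_sum, Finset.smul_sum, sum_inner, Finset.mul_sum]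
    refine Finset.sum_congr rfl fun i _ => ?_
    rw [real_inner_smul_left, real_inner_smul_left, real_inner_smul_left]
    ring
  exact (smul_eq_zero.1 h1).resolve_left hγ.ne'

lemma tendsto_measure_zero_of_subset {Ω : Type*} [MeasurableSpace Ω] {μ : Measure Ω}
    {A B : ℕ → Set Ω} (hB : Tendsto (fun n => μ (B n)) atTop (𝓝 0)) (h : ∀ n, A n ⊆ B n) :
    Tendsto (fun n => μ (A n)) atTop (𝓝 0) :=
  tendsto_of_tendsto_of_tendsto_of_le_of_le tendsto_const_nhds hB (fun _ => zero_le)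
    fun n => measure_mono (h n)

/-- If far parameters eventually have a smaller criterion than `β₀`, maximizers of the criterion
are consistent. -/
lemma tendsto_measure_norm_sub_ge {Ω : Type*} [MeasurableSpace Ω] {μ : Measure Ω}
    [IsProbabilityMeasure μ] (hγ : 0 < γ) {β₀ : Vec p} {X : ℕ → Ω → Vec p} {Y : ℕ → Ω → ℝ}
    (hX : ∀ i, Measurable (X i)) (hY : ∀ i, Measurable (Y i))
    (hY01 : ∀ i ω, Y i ω = 0 ∨ Y i ω = 1)
    {βhat : ℕ → Ω → Vec p} (hβm : ∀ n, AEMeasurable (βhat n) μ)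
    (hβ : Tendsto (fun n => μ {ω | ¬ IsMaxOn
        (criterion γ n (fun i => X i ω) (fun i => Y i ω)) Set.univ (βhat n ω)}) atTop (𝓝 0))
    {ε : ℝ}
    (hlt : ∀ᵐ ω ∂μ, ∀ᶠ n in atTop, ∀ β : Vec p, ε ≤ ‖β - β₀‖ →
      ∑ i ∈ Finset.range n, marginWeight γ ⟪β, signed (X i ω) (Y i ω)⟫ <
        ∑ i ∈ Finset.range n, marginWeight γ ⟪β₀, signed (X i ω) (Y i ω)⟫) :
    Tendsto (fun n => μ {ω | ε ≤ ‖βhat n ω - β₀‖}) atTop (𝓝 0) := by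
  have hV : ∀ i, Measurable fun ω => signed (X i ω) (Y i ω) := fun i =>
    measurable_signed.comp ((hX i).prodMk (hY i))
  have hw := (continuous_marginWeight hγ).measurable
  set B : ℕ → Set Ω := fun n => {ω | ε ≤ ‖βhat n ω - β₀‖} ∩
    {ω | ∑ i ∈ Finset.range n, marginWeight γ ⟪β₀, signed (X i ω) (Y i ω)⟫ ≤
      ∑ i ∈ Finset.range n, marginWeight γ ⟪βhat n ω, signed (X i ω) (Y i ω)⟫} with hBdef
  have hB : Tendsto (fun n => μ (B n)) atTop (𝓝 0) := by
    refine tendsto_measure_zero_of_ae_eventually_notMem (fun n => ?_) ?_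
    · refine (nullMeasurableSet_le aemeasurable_const ((hβm n).sub_const β₀).norm).inter
        (nullMeasurableSet_le ?_ ?_)
      · exact Finset.aemeasurable_fun_sum _ fun i _ =>
          (hw.comp (measurable_const.inner (hV i))).aemeasurable
      · exact Finset.aemeasurable_fun_sum _ fun i _ =>
          hw.comp_aemeasurable ((hβm n).inner (hV i).aemeasurable)
    · filter_upwards [hlt] with ω hω
      filter_upwards [hω] with n hn hmem
      exact absurd hmem.2 (not_le.2 (hn _ hmem.1))
  have hsum := hβ.add hB
  rw [add_zero] at hsum
  refine tendsto_of_tendsto_of_tendsto_of_le_of_le tendsto_const_nhds hsum (fun _ => zero_le)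
    fun n => (measure_mono fun ω hω => ?_).trans (measure_union_le _ _)
  by_cases hmax : IsMaxOn (criterion γ n (fun i => X i ω) (fun i => Y i ω)) Set.univ (βhat n ω)
  · refine Or.inr ⟨hω, ?_⟩
    have h := hmax (Set.mem_univ β₀)
    simp only [Set.mem_ofPred_eq, criterion_eq hγ n _ (fun i => hY01 i ω)] at h ⊢
    rcases Nat.eq_zero_or_pos n with rfl | hn
    · simp
    · have hn' : (0 : ℝ) < 1 / n := by positivity
      exact le_of_mul_le_mul_left h hn'
  · exact Or.inl hmax

end

end GammaLogistic

end

/-! ### Proof of the theorem -/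

open GammaLogistic in
theorem theorem2 {Ω : Type*} [MeasurableSpace Ω] (μ : Measure Ω) [IsProbabilityMeasure μ]
    (p : ℕ) (γ : ℝ) (hγ : 0 < γ) (β₀ : GammaLogistic.Vec p)
    -- an i.i.d. sample `(Xᵢ, Yᵢ)` with labels in `{0, 1}`
    (X : ℕ → Ω → GammaLogistic.Vec p) (Y : ℕ → Ω → ℝ)
    (hX : ∀ i, Measurable (X i)) (hY : ∀ i, Measurable (Y i))
    (hY01 : ∀ i ω, Y i ω = 0 ∨ Y i ω = 1)
    (hindep : iIndepFun (fun i ω => (X i ω, Y i ω)) μ)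
    (hident : ∀ i, IdentDistrib (fun ω => (X i ω, Y i ω)) (fun ω => (X 0 ω, Y 0 ω)) μ μ)
    -- the logistic model: `P(Y = 1 | X) = π(X; β₀)`
    (hmodel : ∀ i, μ⟦Y i ⁻¹' {1} | MeasurableSpace.comap (X i) inferInstance⟧
      =ᵐ[μ] fun ω => GammaLogistic.prob (X i ω) β₀)
    -- `H_γ` is invertible, so that the influence function is defined
    (hH : IsUnit (GammaLogistic.hMat μ γ β₀ (X 0)))
    -- the influence function has a finite second moment, locally uniformly at `β₀`
    (hIF : ∃ δ : ℝ, 0 < δ ∧ ∃ G : Ω → ℝ, Integrable G μ ∧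
      ∀ᵐ ω ∂μ, ∀ β : GammaLogistic.Vec p, ‖β - β₀‖ < δ →
        ‖GammaLogistic.influence γ (GammaLogistic.hMat μ γ β₀ (X 0)) β (X 0 ω) (Y 0 ω)‖ ^ 2
          ≤ G ω)
    -- `βhat n` is the `γ`-logistic estimator, with probability tending to one
    (βhat : ℕ → Ω → GammaLogistic.Vec p) (hβm : ∀ n, AEMeasurable (βhat n) μ)
    (hβ : Tendsto (fun n => μ {ω | ¬ IsMaxOn
        (GammaLogistic.criterion γ n (fun i => X i ω) (fun i => Y i ω)) Set.univ (βhat n ω)})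
      atTop (𝓝 0)) :
    -- the matrices `H_γ`, `U_γ` are finite
    GammaLogistic.HasMean μ (fun ω => GammaLogistic.hInt γ β₀ (X 0 ω)) ∧
    GammaLogistic.HasMean μ (fun ω => GammaLogistic.uInt γ β₀ (X 0 ω) (Y 0 ω)) ∧
    -- `Δ_γ = 0`
    (GammaLogistic.HasMean μ (fun ω => GammaLogistic.deltaInt γ β₀ (X 0 ω) (Y 0 ω)) ∧
      GammaLogistic.mean μ (fun ω => GammaLogistic.deltaInt γ β₀ (X 0 ω) (Y 0 ω)) = 0) ∧
    -- `H_γ = E[-∂S_γ/∂β]` at `β₀`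
    (GammaLogistic.HasMean μ (fun ω => GammaLogistic.negJac γ β₀ (X 0 ω) (Y 0 ω)) ∧
      GammaLogistic.mean μ (fun ω => GammaLogistic.negJac γ β₀ (X 0 ω) (Y 0 ω))
        = GammaLogistic.hMat μ γ β₀ (X 0)) ∧
    -- the estimator solves `S_γ(βhat) = 0`, with probability tending to one
    Tendsto (fun n => μ {ω |
        GammaLogistic.estFun γ n (fun i => X i ω) (fun i => Y i ω) (βhat n ω) ≠ 0})
      atTop (𝓝 0) ∧
    -- asymptotic normality
    TendstoInDistribution (fun (n : ℕ) ω => √(n : ℝ) • (βhat n ω - β₀)) atTop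
      (id : GammaLogistic.Vec p → GammaLogistic.Vec p) (fun _ => μ)
      (multivariateGaussian 0
        ((GammaLogistic.hMat μ γ β₀ (X 0))⁻¹ * GammaLogistic.uMat μ γ β₀ (X 0) (Y 0) *
          (GammaLogistic.hMat μ γ β₀ (X 0))⁻¹)) := by
  set H := hMat μ γ β₀ (X 0) with hHdef
  set V : ℕ → Ω → Vec p := fun i ω => signed (X i ω) (Y i ω) with hVdef
  have hVm : ∀ i, Measurable (V i) := fun i => measurable_signed.comp ((hX i).prodMk (hY i))
  have hVi : iIndepFun V μ :=
    hindep.comp (fun _ z => signed z.1 z.2) fun _ => measurable_signed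
  have hVd : ∀ i, IdentDistrib (V i) (V 0) μ μ := fun i => (hident i).comp measurable_signed
  -- since `H` is invertible, the score is dominated along with the influence function
  obtain ⟨δ, hδ, G, hG, hGb⟩ := hIF
  obtain ⟨C, hC, hCb⟩ := exists_exp_neg_margin_mul_sq_le hγ hδ β₀
  set NH := ‖Matrix.toEuclideanCLM (𝕜 := ℝ) H‖ with hNH
  set D : Ω → ℝ := fun ω => C * (NH ^ 2 * G ω + 1) with hDdef
  have hD : Integrable D μ := ((hG.const_mul _).add (integrable_const _)).const_mul _
  have hdomV : ∀ᵐ ω ∂μ, ∀ β : Vec p, ‖β - β₀‖ ≤ δ / 2 →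
      Real.exp (-(γ * |⟪β, V 0 ω⟫|)) * ‖V 0 ω‖ ^ 2 ≤ D ω := by
    filter_upwards [hGb] with ω hω
    refine hCb (V 0 ω) _ fun β hβ => ?_
    have hsc : score γ β (X 0 ω) (Y 0 ω) =
        Matrix.toEuclideanCLM (𝕜 := ℝ) H (influence γ H β (X 0 ω) (Y 0 ω)) := by
      have h1 : influence γ H β (X 0 ω) (Y 0 ω) =
          Matrix.toEuclideanCLM (𝕜 := ℝ) H⁻¹ (score γ β (X 0 ω) (Y 0 ω)) := rfl
      rw [h1, ← ContinuousLinearMap.comp_apply, ← ContinuousLinearMap.mul_def, ← map_mul,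
        Matrix.mul_nonsing_inv _ ((Matrix.isUnit_iff_isUnit_det _).1 hH), map_one]
      rfl
    have h2 : marginScore γ ⟪β, V 0 ω⟫ ^ 2 * ‖V 0 ω‖ ^ 2 =
        ‖score γ β (X 0 ω) (Y 0 ω)‖ ^ 2 := by
      rw [score_eq (hY01 0 ω), norm_smul, mul_pow, Real.norm_eq_abs, sq_abs]
    rw [h2, hsc]
    calc _ ≤ (NH * ‖influence γ H β (X 0 ω) (Y 0 ω)‖) ^ 2 := by
          gcongr
          exact ContinuousLinearMap.le_opNorm _ _
      _ ≤ NH ^ 2 * G ω := by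
          rw [mul_pow]
          gcongr
          exact hω β hβ
  have hβ₀r : ‖β₀ - β₀‖ ≤ δ / 2 := by rw [sub_self, norm_zero]; positivity
  have hdomX : ∀ᵐ ω ∂μ, Real.exp (-(γ * |⟪β₀, X 0 ω⟫|)) * ‖X 0 ω‖ ^ 2 ≤ D ω := by
    filter_upwards [hdomV] with ω hω
    have := hω β₀ hβ₀r
    rwa [hVdef, abs_inner_signed (hY01 0 ω), norm_signed (hY01 0 ω)] at this
  have hdomV0 : ∀ᵐ ω ∂μ, Real.exp (-(γ * |⟪β₀, V 0 ω⟫|)) * ‖V 0 ω‖ ^ 2 ≤ D ω :=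
    hdomV.mono fun ω hω => hω β₀ hβ₀r
  have hdomN : ∀ᵐ ω ∂μ, Real.exp (-(γ * |⟪β₀, -X 0 ω⟫|)) * ‖-X 0 ω‖ ^ 2 ≤ D ω := by
    simpa using hdomX
  -- conditional averaging of `c ⟪β₀, V⟫ • V Vᵀ`
  have hcond : ∀ {c : ℝ → ℝ} {M : ℝ}, Continuous c →
      (∀ t, |c t| ≤ M * Real.exp (-(γ * |t|))) → ∀ i j,
      ∫ ω, outer (c ⟪β₀, V 0 ω⟫) (V 0 ω) i j ∂μ =
        ∫ ω, outer (Real.sigmoid ⟪β₀, X 0 ω⟫ * c ⟪β₀, X 0 ω⟫ +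
          (1 - Real.sigmoid ⟪β₀, X 0 ω⟫) * c ⟪β₀, -X 0 ω⟫) (X 0 ω) i j ∂μ := by
    intro c M hc hM i j
    have hm : Measurable fun x : Vec p => outer (c ⟪β₀, x⟫) x i j :=
      measurable_outer (c := fun x => c ⟪β₀, x⟫) (Continuous.measurable (by fun_prop)) i j
    rw [integral_comp_signed (hX 0) (hY 0) (hY01 0) (hmodel 0) hm
      (hasMean_outer hc hM (hX 0) hD hdomX i j) (hasMean_outer hc hM (hX 0).neg hD hdomN i j)]
    refine integral_congr_ae (ae_of_all _ fun ω => ?_)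
    simp only [outer, Matrix.of_apply, PiLp.neg_apply]
    ring
  have hHV : mean μ (fun ω => outer (hFactor γ ⟪β₀, V 0 ω⟫) (V 0 ω)) = H := by
    ext i j
    rw [mean, Matrix.of_apply, hcond (continuous_hFactor hγ) (abs_hFactor_le hγ), hHdef, hMat,
      mean, Matrix.of_apply]
    simp_rw [hInt_eq hγ]
  have hiH := hasMean_outer (continuous_hFactor hγ) (abs_hFactor_le hγ) (hVm 0) hD hdomV0
  have hiD := hasMean_outer (continuous_deltaFactor hγ) (abs_deltaFactor_le hγ) (hVm 0) hD hdomV0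
  have hiU : HasMean μ fun ω => outer (marginScore γ ⟪β₀, V 0 ω⟫ ^ 2) (V 0 ω) :=
    hasMean_outer ((continuous_marginScore hγ).pow 2) (abs_marginScore_sq_le hγ)
      (hVm 0) hD hdomV0
  have hiK := hasMean_outer (continuous_marginCurv hγ) (abs_marginCurv_le hγ) (hVm 0) hD hdomV0
  have hD0 : mean μ (fun ω => outer (deltaFactor γ ⟪β₀, V 0 ω⟫) (V 0 ω)) = 0 := by
    ext i j
    rw [mean, Matrix.of_apply, hcond (continuous_deltaFactor hγ) (abs_deltaFactor_le hγ)]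
    simp_rw [inner_neg_right, sigmoid_mul_deltaFactor_add hγ]
    simp [outer]
  have hKH : mean μ (fun ω => outer (marginCurv γ ⟪β₀, V 0 ω⟫) (V 0 ω)) = H := by
    have h : mean μ (fun ω => outer (marginCurv γ ⟪β₀, V 0 ω⟫) (V 0 ω)) =
        mean μ (fun ω => outer (hFactor γ ⟪β₀, V 0 ω⟫) (V 0 ω)) +
          mean μ (fun ω => outer (deltaFactor γ ⟪β₀, V 0 ω⟫) (V 0 ω)) := by
      ext i j
      simp only [mean, Matrix.of_apply, Matrix.add_apply]
      rw [← integral_add (hiH i j) (hiD i j)]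
      refine integral_congr_ae (ae_of_all _ fun ω => ?_)
      simp only [outer, Matrix.of_apply, marginCurv_eq_add]
      ring
    rw [h, hHV, hD0, add_zero]
  have hUV : (fun ω => uInt γ β₀ (X 0 ω) (Y 0 ω)) =
      fun ω => outer (marginScore γ ⟪β₀, V 0 ω⟫ ^ 2) (V 0 ω) :=
    funext fun ω => uInt_eq (hY01 0 ω) _ _
  have hDV : (fun ω => deltaInt γ β₀ (X 0 ω) (Y 0 ω)) =
      fun ω => outer (deltaFactor γ ⟪β₀, V 0 ω⟫) (V 0 ω) :=
    funext fun ω => deltaInt_eq (hY01 0 ω) _ _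
  have hJV : (fun ω => negJac γ β₀ (X 0 ω) (Y 0 ω)) =
      fun ω => outer (marginCurv γ ⟪β₀, V 0 ω⟫) (V 0 ω) :=
    funext fun ω => negJac_eq hγ (hY01 0 ω) _ _
  have hHint : HasMean μ fun ω => hInt γ β₀ (X 0 ω) := by
    have hσ : Continuous fun t : ℝ => Real.sigmoid t * hFactor γ t +
        (1 - Real.sigmoid t) * hFactor γ (-t) := by
      have := continuous_hFactor hγ
      have := continuous_sigmoid
      fun_prop
    have hb : ∀ t, |Real.sigmoid t * hFactor γ t + (1 - Real.sigmoid t) * hFactor γ (-t)| ≤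
        1 * Real.exp (-(γ * |t|)) := fun t => by
      have h1 := (le_abs_self _).trans (abs_hFactor_le hγ t)
      have h2 := (le_abs_self _).trans (abs_hFactor_le hγ (-t))
      rw [abs_neg] at h2
      have h3 := Real.sigmoid_pos t
      have h4 := one_sub_sigmoid_pos t
      have h5 := hFactor_nonneg γ t
      have h6 := hFactor_nonneg γ (-t)
      rw [abs_of_nonneg (by positivity)]
      nlinarith
    have h := hasMean_outer hσ hb (hX 0) hD hdomX
    simpa only [hInt_eq hγ, inner_neg_right] using h
  have hrootE : Tendsto (fun n => μ {ω |
      estFun γ n (fun i => X i ω) (fun i => Y i ω) (βhat n ω) ≠ 0}) atTop (𝓝 0) :=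
    tendsto_measure_zero_of_subset hβ fun n ω hω hmax =>
      hω (estFun_eq_zero_of_isMaxOn hγ (fun i => hY01 i ω) hmax)
  refine ⟨hHint, hUV ▸ hiU, ⟨hDV ▸ hiD, by rw [hDV, hD0]⟩, ⟨hJV ▸ hiK, by rw [hJV, hKH]⟩,
    hrootE, ?_⟩
  -- consistency
  have hnd : ∀ W : Submodule ℝ (Vec p), (∀ᵐ ω ∂μ, X 0 ω ∈ W) → W = ⊤ := fun W hW =>
    eq_top_of_isUnit_mean_outer hHint hH W hW
  have hcons : ∀ ε : ℝ, 0 < ε → Tendsto (fun n => μ {ω | ε ≤ ‖βhat n ω - β₀‖}) atTop (𝓝 0) :=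
    fun ε hε => tendsto_measure_norm_sub_ge hγ hX hY hY01 hβm hβ
      (ae_eventually_forall_sum_lt hγ hX hY hY01 hindep hident (hmodel 0) hnd hε)
  have hrootV : Tendsto (fun n => μ {ω | ∑ i ∈ Finset.range n,
      marginScore γ ⟪βhat n ω, V i ω⟫ • V i ω ≠ 0}) atTop (𝓝 0) := by
    refine tendsto_measure_zero_of_subset hrootE fun n ω hω => ?_
    rcases Nat.eq_zero_or_pos n with rfl | hn
    · simp at hω
    · have hn' : (1 / (n : ℝ)) ≠ 0 := by positivity
      rw [Set.mem_ofPred_eq, estFun_eq n _ fun i => hY01 i ω]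
      exact smul_ne_zero hn' hω
  -- the influence functions satisfy the central limit theorem
  set A := Matrix.toEuclideanCLM (𝕜 := ℝ) H⁻¹ with hA
  set Z : ℕ → Ω → Vec p := fun i ω => A (marginScore γ ⟪β₀, V i ω⟫ • V i ω) with hZdef
  set U := uMat μ γ β₀ (X 0) (Y 0) with hUdef
  have hUmean : U = mean μ fun ω => outer (marginScore γ ⟪β₀, V 0 ω⟫ ^ 2) (V 0 ω) := by
    rw [hUdef, uMat, hUV]
  have hHT : (H⁻¹).transpose = H⁻¹ := by
    rw [Matrix.transpose_nonsing_inv, ← hHV, transpose_mean_outer]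
  have hψm : Measurable fun v : Vec p => A (marginScore γ ⟪β₀, v⟫ • v) := by
    have := continuous_marginScore hγ
    exact Continuous.measurable (by fun_prop)
  have hadj : ∀ u v : Vec p, ⟪u, A v⟫ = ⟪A u, v⟫ := fun u v => by
    rw [hA, Matrix.inner_toEuclideanCLM, real_inner_comm, Matrix.inner_toEuclideanCLM,
      Matrix.dotProduct_mulVec u.ofLp, ← Matrix.mulVec_transpose, hHT, dotProduct_comm]
  have hL2 : ∀ {W : Ω → Vec p}, Measurable W →
      (∀ᵐ ω ∂μ, Real.exp (-(γ * |⟪β₀, W ω⟫|)) * ‖W ω‖ ^ 2 ≤ D ω) → ∀ u : Vec p,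
      MemLp (fun ω => ⟪u, A (marginScore γ ⟪β₀, W ω⟫ • W ω)⟫) 2 μ := by
    intro W hW hdom u
    have hm : AEStronglyMeasurable (fun ω => ⟪u, A (marginScore γ ⟪β₀, W ω⟫ • W ω)⟫) μ :=
      (measurable_const.inner (hψm.comp hW)).aestronglyMeasurable
    refine (memLp_two_iff_integrable_sq hm).2 ?_
    refine (hD.const_mul (‖A u‖ ^ 2)).mono' (hm.pow 2) ?_
    filter_upwards [hdom] with ω hω
    rw [hadj, real_inner_smul_right, norm_pow, norm_mul, mul_pow, Real.norm_eq_abs, sq_abs]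
    have h1 : ‖⟪A u, W ω⟫‖ ≤ ‖A u‖ * ‖W ω‖ := norm_inner_le_norm _ _
    have h2 := (le_abs_self _).trans (abs_marginScore_sq_le hγ ⟪β₀, W ω⟫)
    calc _ ≤ (1 * Real.exp (-(γ * |⟪β₀, W ω⟫|))) * (‖A u‖ * ‖W ω‖) ^ 2 := by gcongr
      _ = ‖A u‖ ^ 2 * (Real.exp (-(γ * |⟪β₀, W ω⟫|)) * ‖W ω‖ ^ 2) := by ring
      _ ≤ ‖A u‖ ^ 2 * D ω := by gcongr
  have hmean : ∀ u : Vec p, ∫ ω, ⟪u, Z 0 ω⟫ ∂μ = 0 := by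
    intro u
    have hfm : Measurable fun v : Vec p => ⟪u, A (marginScore γ ⟪β₀, v⟫ • v)⟫ :=
      measurable_const.inner hψm
    have h := integral_comp_signed (hX 0) (hY 0) (hY01 0) (hmodel 0) hfm
      ((hL2 (hX 0) hdomX u).integrable one_le_two) ((hL2 (hX 0).neg hdomN u).integrable one_le_two)
    refine h.trans (integral_eq_zero_of_ae (ae_of_all _ fun ω => ?_))
    simp only [hadj, real_inner_smul_right, inner_neg_right, Pi.zero_apply]
    linear_combination ⟪A u, X 0 ω⟫ * sigmoid_mul_marginScore hγ ⟪β₀, X 0 ω⟫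
  have hquad : ∀ w : Vec p, w.ofLp ⬝ᵥ U.mulVec w.ofLp =
      ∫ ω, marginScore γ ⟪β₀, V 0 ω⟫ ^ 2 * ⟪w, V 0 ω⟫ ^ 2 ∂μ := fun w => by
    rw [hUmean, integral_mul_inner_sq hiU]
  have hUpsd : U.PosSemidef := by
    refine Matrix.PosSemidef.of_dotProduct_mulVec_nonneg ?_ fun w => ?_
    · rw [Matrix.IsHermitian, Matrix.conjTranspose_eq_transpose_of_trivial, hUmean,
        transpose_mean_outer]
    · have h := hquad (WithLp.toLp 2 w)
      simp only [star_trivial]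
      rw [h]
      exact integral_nonneg fun ω => by positivity
  have hSpsd : (H⁻¹ * U * H⁻¹).PosSemidef := by
    have h := hUpsd.mul_mul_conjTranspose_same H⁻¹
    rwa [Matrix.conjTranspose_eq_transpose_of_trivial, hHT] at h
  have hcov : ∀ u : Vec p, ∫ ω, ⟪u, Z 0 ω⟫ ^ 2 ∂μ = u.ofLp ⬝ᵥ (H⁻¹ * U * H⁻¹).mulVec u.ofLp := by
    intro u
    have h1 : u.ofLp ⬝ᵥ (H⁻¹ * U * H⁻¹).mulVec u.ofLp =
        (A u).ofLp ⬝ᵥ U.mulVec (A u).ofLp := by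
      rw [hA, Matrix.ofLp_toEuclideanCLM, ← Matrix.mulVec_mulVec, ← Matrix.mulVec_mulVec,
        Matrix.dotProduct_mulVec, ← Matrix.mulVec_transpose, hHT]
    rw [h1, hquad]
    refine integral_congr_ae (ae_of_all _ fun ω => ?_)
    simp only [hZdef, hadj, real_inner_smul_right]
    ring
  have hclt := tendstoInDistribution_inv_sqrt_smul_sum (Z := Z) (μ := μ)
    (hVi.comp (fun _ v => A (marginScore γ ⟪β₀, v⟫ • v)) fun _ => hψm)
    (fun i => (hVd i).comp hψm) (hL2 (hVm 0) hdomV0) hmean hSpsd hcov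
  -- the estimator is asymptotically linear with these influence functions
  refine tendstoInDistribution_of_relative_error hclt
    (fun n => ((hβm n).sub_const β₀).fun_const_smul _) fun c hc => ?_
  refine tendsto_measure_relative_error hVm hVi hVd (hasDerivAt_marginScore hγ)
    (continuous_marginCurv hγ) hH hiK hKH (half_pos hδ) (hD.const_mul (γ + 1)) ?_ hcons hrootV hc
  filter_upwards [hdomV] with ω hω β hβ'
  calc _ ≤ (γ + 1) * Real.exp (-(γ * |⟪β, V 0 ω⟫|)) * ‖V 0 ω‖ ^ 2 := by
        gcongr
        exact abs_marginCurv_le hγ _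
    _ ≤ (γ + 1) * D ω := by
        rw [mul_assoc]
        gcongr
        exact hω β hβ'
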